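/- For a prime $p$ and $c\in\mathbb N$ let $\mathcal L$ be the free Lie algebra over $\mathbb F_p$ on two generators $X_1,X_2$, realised as the Lie subalgebra generated by $X_1,X_2$ in the free associative algebra $\mathbb F_p\langle X_1,X_2\rangle$ with $[P,Q]=PQ-QP$. Let $L=\mathfrak f_{c,2}(\mathbb F_p)=\mathcal L/\gamma_{c+1}(\mathcal L)$ be the free nilpotent Lie algebra of class $c$, let $L_k\le L$ be the image of the space of homogeneous Lie polynomials of degree $k$, and for $j=1,2$ let $\phi_j:L\to L$, $\phi_j(w)=[X_j,w]$. For a subspace $I_k\le L_k$ put $\dim_{col}(I_k)=\dim(\phi_1(I_k)\cap\phi_2(I_k))$. Theorem. Let $k>1$. There are non-negative integers $d_k$ and $l_{k+1}$, depending only on $k$, such that for all integers $m,i\ge 0$ there is a polynomial $P_{k,m,i}\in\mathbb Z[T]$ with the following property. For every $c$ with $k\le c-1$ and every prime $p\ge c$, one has $\dim L_k=d_k$ and $\dim(\phi_1(L_k)\cap\phi_2(L_k))=l_{k+1}$, and the number $f_k(m,i,p)$ of subspaces $I_k\le L_k$ with $\dim I_k=m$ and $\dim_{col}(I_k)=i$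 satisfies $$f_k(m,i,p)=P_{k,m,i}(p)$$ and, explicitly, $$f_k(m,i,p)=\sum_{j=i}^{l_{k+1}}\binom{l_{k+1}}{j}_p\binom{j}{i}_p\sum_{r=0}^{\min\{l_{k+1}-j,\;j-i,\;m-j-i\}}p^{(l_{k+1}-i-r)(m-j-i-r)}\binom{l_{k+1}-j}{r}_p\binom{j-i}{r}_p\binom{d_k-l_{k+1}-j}{m-j-i-r}_p\prod_{e=0}^{r-1}(p^r-p^e),$$ where the inner sum is empty if its upper limit is negative. Here, for $n,s\ge 0$, $\binom{n}{s}_p=\prod_{e=0}^{s-1}\frac{1-p^{n-e}}{1-p^{e+1}}$ if $s\le n$, and $\binom{n}{s}_p=0$ if $s>n$. -/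

import Mathlib

open Polynomial

attribute [local instance 100] LieRing.ofAssociativeRing

noncomputable section

namespace FreeNilLie

/-- `L_K(X)`: the Lie algebra of Lie polynomials in the two letters `X₁, X₂` (indexed by `Fin 2`),
i.e. the smallest Lie subalgebra of `K⟨X₁, X₂⟩`, with bracket `[P, Q] = P Q - Q P`, that contains
both letters.  It is the free Lie algebra on two generators over `K`. -/
abbrev LiePoly (K : Type) [Field K] : LieSubalgebra K (FreeAlgebra K (Fin 2)) :=
  LieSubalgebra.lieSpan K (FreeAlgebra K (Fin 2)) (Set.range (FreeAlgebra.ι K))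

/-- `K⟨X₁, X₂⟩_k`: the span of the words of length `k`. -/
def wordSpan (K : Type) [Field K] (k : ℕ) : Submodule K (FreeAlgebra K (Fin 2)) :=
  Submodule.span K {a | ∃ w : List (Fin 2), w.length = k ∧ a = (w.map (FreeAlgebra.ι K)).prod}

/-- `𝔣_{c,2}(K)`: the free class-`c` nilpotent Lie algebra on two generators, the quotient of the
free Lie algebra by the term `γ_{c+1}` of its lower central series.  (Mathlib's
`lowerCentralSeries` starts from index `0`, so that its index `c` is `γ_{c+1}`.) -/
abbrev FreeNilp (K : Type) [Field K] (c : ℕ) : Type :=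
  LiePoly K ⧸ LieModule.lowerCentralSeries K (LiePoly K) (LiePoly K) c

/-- The quotient map from Lie polynomials onto `𝔣_{c,2}(K)`. -/
def proj (K : Type) [Field K] (c : ℕ) : LiePoly K →ₗ[K] FreeNilp K c :=
  (LieModule.lowerCentralSeries K (LiePoly K) (LiePoly K) c).toSubmodule.mkQ

/-- The generator `X_{j+1}` of `𝔣_{c,2}(K)`. -/
def gen (K : Type) [Field K] (c : ℕ) (j : Fin 2) : FreeNilp K c :=
  proj K c ⟨FreeAlgebra.ι K j, LieSubalgebra.subset_lieSpan ⟨j, rfl⟩⟩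

/-- The homogeneous component `L_k` of `L = 𝔣_{c,2}(K)`: the classes of the Lie polynomials
that are homogeneous of degree `k`. -/
def layer (K : Type) [Field K] (c k : ℕ) : Submodule K (FreeNilp K c) :=
  ((wordSpan K k).comap (LiePoly K).toSubmodule.subtype).map (proj K c)

/-- `w ↦ [X_{j+1}, w]` on `𝔣_{c,2}(K)`. -/
def phi (K : Type) [Field K] (c : ℕ) (j : Fin 2) : FreeNilp K c →ₗ[K] FreeNilp K c :=
  LieAlgebra.ad K (FreeNilp K c) (gen K c j)

/-- `φ₁(I) ∩ φ₂(I)`. -/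
def collapse (K : Type) [Field K] (c : ℕ) (I : Submodule K (FreeNilp K c)) :
    Submodule K (FreeNilp K c) :=
  I.map (phi K c 0) ⊓ I.map (phi K c 1)

/-- The dimension of collapse `dim_col(I) = dim (φ₁(I) ∩ φ₂(I))`. -/
def dimCol (K : Type) [Field K] (c : ℕ) (I : Submodule K (FreeNilp K c)) : ℕ :=
  Module.finrank K (collapse K c I)

/-- The number of subspaces `I ≤ L_k` of `𝔣_{c,2}(K)` with `dim I = m` and `dim_col(I) = i`. -/
def countCol (K : Type) [Field K] (c k m i : ℕ) : ℕ :=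
  Nat.card {I : Submodule K (FreeNilp K c) //
    I ≤ layer K c k ∧ Module.finrank K I = m ∧ dimCol K c I = i}

/-- The Gaussian binomial coefficient
`(1 - q^n)(1 - q^(n-1)) ⋯ (1 - q^(n-i+1)) / ((1 - q)(1 - q^2) ⋯ (1 - q^i))`, and `0` if `n < i`. -/
def gaussBinom (q : ℚ) (n i : ℕ) : ℚ :=
  if i ≤ n then
    (∏ e ∈ Finset.range i, (1 - q ^ (n - e))) / ∏ e ∈ Finset.range i, (1 - q ^ (e + 1))
  else 0

/-- The explicit counting formula: a sum over `i ≤ j ≤ l` and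
`0 ≤ r ≤ min (l - j) (j - i) (m - j - i)`. -/
def colFormula (d l m i : ℕ) (q : ℚ) : ℚ :=
  ∑ j ∈ Finset.Icc i l, gaussBinom q l j * gaussBinom q j i *
    ∑ r ∈ (Finset.range (l + 1)).filter (fun r => j + r ≤ l ∧ i + r ≤ j ∧ i + j + r ≤ m),
      q ^ ((l - i - r) * (m - j - i - r)) *
        gaussBinom q (l - j) r * gaussBinom q (j - i) r * gaussBinom q (d - l - j) (m - j - i - r) *
        ∏ e ∈ Finset.range r, (q ^ r - q ^ e)

end FreeNilLie

end

namespace FreeNilLie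

/-! ### Counting subspaces in prescribed position to one or two given subspaces -/

section Counting

open Module Submodule

/-! The theorem combines a linear-algebra count, a property of free Lie algebras and a dimension
that does not depend on `p`.

Count (`card_finrank_map_inf_map`). Let `f, g : V → E` be injective, `U = f⁻¹(im g)`, and let `σ =
g⁻¹ ∘ f` carry `U` onto `g⁻¹(im f)`. Then `f(I) ∩ g(I)` is isomorphic to `I ∩ σ(I ∩ U)`. If `U` and
`σ(U)` are disjoint, one chooses `J = I ∩ U` of dimension `j`, then `S = I ∩ σ(J)` of dimension `i`,
and works modulo `J ⊕ S`. There remain the subspaces that avoid two disjoint subspaces of dimensions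
`l - j` and `j - i`; they are sorted by the dimension `r` of their intersection with the sum of the
two. The result is the stated formula, and the `q`-Pascal rule makes it an integer polynomial in
`q`.

Lie property (`eq_zero_of_lie_eq_lie`, `eq_zero_of_lie_eq_zero`). The maps `[X₁, ·]` and `[X₂, ·]`
satisfy these hypotheses in degree `k`. Comparing coefficients of words shows that an offending `u`
has cyclically invariant coefficients. A Lie polynomial of degree at least two is a sum of
commutators, so its coefficients sum to zero over the rotations of a word. Hence `k` times each
coefficient vanishes, and `k` is invertible because `k < p`.

Dimensions (`finrank_lieDeg`). The degree `n` component is the image of an integer matrix `A` with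
`A² = AD`, where `D` is diagonal with entries invertible modulo `p`. For such `A` the rank modulo
`p` equals the rank over `ℚ`. Finally `L_{k+1} = [X₁, L_k] + [X₂, L_k]` gives `l_{k+1} = 2 d_k -
d_{k+1}`. -/

theorem card_subtype_eq_sum_fiber {α : Type*} [Finite α] {P : α → Prop} (h : α → ℕ)
    (T : Finset ℕ) (hT : ∀ x, P x → h x ∈ T) :
    Nat.card {x // P x} = ∑ r ∈ T, Nat.card {x // P x ∧ h x = r} := by
  classical
  have := Fintype.ofFinite α
  simp only [Nat.card_eq_fintype_card, Fintype.card_subtype]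
  rw [Finset.card_eq_sum_card_fiberwise (f := h) (t := T) (fun x hx => hT x (by simpa using hx))]
  simp [Finset.filter_filter]

theorem card_subtype_eq_card_mul {α β : Type*} [Finite α] [Finite β] {P : α → Prop}
    {Q : β → Prop} (h : α → β) (c : ℚ) (hQ : ∀ x, P x → Q (h x))
    (hc : ∀ y, Q y → (Nat.card {x // P x ∧ h x = y} : ℚ) = c) :
    (Nat.card {x // P x} : ℚ) = Nat.card {y // Q y} * c := by
  classical
  have := Fintype.ofFinite α
  have := Fintype.ofFinite β
  simp only [Nat.card_eq_fintype_card, Fintype.card_subtype] at hc ⊢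
  rw [Finset.card_eq_sum_card_fiberwise (f := h) (t := Finset.univ.filter Q)
    (fun x hx => by simpa using hQ x (by simpa using hx))]
  rw [Nat.cast_sum, ← nsmul_eq_mul]
  refine Finset.sum_eq_card_nsmul fun y hy => ?_
  rw [← hc y (by simpa using hy), Finset.filter_filter]

/-- The product `∏_{e < s} (q ^ n - q ^ e)`. -/
def fallProd (q : ℚ) (n s : ℕ) : ℚ := ∏ e ∈ Finset.range s, (q ^ n - q ^ e)

theorem fallProd_eq_zero {q : ℚ} {n s : ℕ} (h : n < s) : fallProd q n s = 0 :=
  Finset.prod_eq_zero (Finset.mem_range.2 h) (by simp)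

theorem fallProd_ne_zero {q : ℚ} (hq : 1 < q) (n : ℕ) : fallProd q n n ≠ 0 := by
  refine Finset.prod_ne_zero_iff.2 fun e he => ?_
  have := pow_lt_pow_right₀ hq (Finset.mem_range.1 he)
  exact sub_ne_zero.2 this.ne'

theorem fallProd_eq_gaussBinom_mul {q : ℚ} (hq : 1 < q) (n s : ℕ) :
    fallProd q n s = gaussBinom q n s * fallProd q s s := by
  rcases lt_or_ge n s with h | h
  · rw [fallProd_eq_zero h, gaussBinom, if_neg (by omega), zero_mul]
  have key : ∀ m : ℕ, s ≤ m → fallProd q m s =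
      (∏ e ∈ Finset.range s, (-q ^ e)) * ∏ e ∈ Finset.range s, (1 - q ^ (m - e)) := by
    intro m hm
    rw [fallProd, ← Finset.prod_mul_distrib]
    refine Finset.prod_congr rfl fun e he => ?_
    have : m = e + (m - e) := by have := Finset.mem_range.1 he; omega
    conv_lhs => rw [this, pow_add]
    ring
  have hrev : ∏ e ∈ Finset.range s, (1 - q ^ (s - e)) = ∏ e ∈ Finset.range s, (1 - q ^ (e + 1)) := by
    rw [← Finset.prod_range_reflect]
    refine Finset.prod_congr rfl fun e he => ?_
    have : s - (s - 1 - e) = e + 1 := by have := Finset.mem_range.1 he; omega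
    rw [this]
  have hne : ∏ e ∈ Finset.range s, (1 - q ^ (e + 1)) ≠ 0 := by
    refine Finset.prod_ne_zero_iff.2 fun e _ => ?_
    exact sub_ne_zero.2 (one_lt_pow₀ hq (by omega)).ne
  rw [key n h, key s le_rfl, hrev, gaussBinom, if_pos h]
  field_simp

variable {F V : Type*} [Field F] [Fintype F] [AddCommGroup V] [Module F V] [Finite V]

theorem one_lt_card_rat (F : Type*) [Field F] [Fintype F] : (1 : ℚ) < Fintype.card F := by
  exact_mod_cast Fintype.one_lt_card

theorem card_linearIndependent_rat (s : ℕ) :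
    (Nat.card {v : Fin s → V // LinearIndependent F v} : ℚ) =
      fallProd (Fintype.card F) (finrank F V) s := by
  rcases lt_or_ge (finrank F V) s with h | h
  · rw [fallProd_eq_zero h]
    have : IsEmpty {v : Fin s → V // LinearIndependent F v} :=
      ⟨fun v => h.not_ge (by simpa using v.2.fintype_card_le_finrank)⟩
    simp
  · rw [card_linearIndependent h, fallProd, ← Fin.prod_univ_eq_prod_range, Nat.cast_prod]
    refine Finset.prod_congr rfl fun i _ => ?_
    rw [Nat.cast_sub (Nat.pow_le_pow_right Fintype.card_pos (by omega))]
    simp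

/-- Every `s`-dimensional subspace has the same number of ordered bases, so subspaces can be counted
through independent tuples. -/
theorem card_tuples_eq (s : ℕ) (P : Submodule F V → Prop) :
    (Nat.card {v : Fin s → V // LinearIndependent F v ∧ P (span F (Set.range v))} : ℚ) =
      Nat.card {I : Submodule F V // finrank F I = s ∧ P I} *
        fallProd (Fintype.card F) s s := by
  refine card_subtype_eq_card_mul (fun v => span F (Set.range v)) _
    (fun v hv => ⟨by simpa using finrank_span_eq_card hv.1, hv.2⟩) fun I hI => ?_
  rw [← hI.1, ← card_linearIndependent_rat, hI.1]
  congr 1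
  refine Nat.card_congr
    { toFun := fun v => ⟨fun j => ⟨v.1 j, ?_⟩, ?_⟩
      invFun := fun w => ⟨fun j => (w.1 j : V), ?_⟩
      left_inv := fun v => rfl
      right_inv := fun w => rfl }
  · have := v.2.2
    exact this.le (subset_span ⟨j, rfl⟩)
  · refine LinearIndependent.of_comp I.subtype ?_
    exact v.2.1.1
  · have hw : LinearIndependent F (fun j => (w.1 j : V)) := w.2.map' I.subtype I.ker_subtype
    have hs : span F (Set.range fun j => (w.1 j : V)) = I := by
      refine Submodule.eq_of_le_of_finrank_eq (span_le.2 ?_) ?_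
      · rintro _ ⟨j, rfl⟩
        exact (w.1 j).2
      · rw [finrank_span_eq_card hw, hI.1, Fintype.card_fin]
    exact ⟨⟨hw, by rw [hs]; exact hI.2⟩, hs⟩

theorem linearIndependent_comp_iff {F V V' : Type*} [Field F] [AddCommGroup V] [Module F V]
    [AddCommGroup V'] [Module F V'] (f : V →ₗ[F] V') {s : ℕ} (v : Fin s → V) :
    LinearIndependent F (f ∘ v) ↔
      LinearIndependent F v ∧ Disjoint (span F (Set.range v)) (LinearMap.ker f) :=
  ⟨fun h => ⟨h.of_comp f, range_ker_disjoint h⟩,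
    fun h => (f.linearIndependent_iff_of_disjoint h.2).2 h.1⟩

theorem card_fiber_comp_mkQ {F V : Type*} [Field F] [AddCommGroup V] [Module F V] (A : Submodule F V) {s : ℕ} (w : Fin s → V ⧸ A) :
    Nat.card {v : Fin s → V // A.mkQ ∘ v = w} = Nat.card A ^ s := by
  obtain ⟨v₀, rfl⟩ : ∃ v₀ : Fin s → V, A.mkQ ∘ v₀ = w :=
    ⟨fun j => (A.mkQ_surjective (w j)).choose,
      funext fun j => (A.mkQ_surjective (w j)).choose_spec⟩
  rw [show Nat.card A ^ s = Nat.card (Fin s → A) by rw [Nat.card_fun, Nat.card_eq_fintype_card (α := Fin s), Fintype.card_fin]]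
  refine Nat.card_congr
    { toFun := fun v j => ⟨v.1 j - v₀ j, ?_⟩
      invFun := fun a => ⟨fun j => a j + v₀ j, ?_⟩
      left_inv := fun v => by ext j; simp
      right_inv := fun a => by ext j; simp }
  · have := congrFun v.2 j
    exact (Submodule.Quotient.eq A).1 this
  · ext j
    simp

/-- The number of `s`-dimensional subspaces that meet a given subspace trivially. -/
theorem card_disjoint (s : ℕ) (A : Submodule F V) :
    (Nat.card {I : Submodule F V // finrank F I = s ∧ Disjoint I A} : ℚ) =
      (Fintype.card F : ℚ) ^ (finrank F A * s) *
        gaussBinom (Fintype.card F) (finrank F V - finrank F A) s := by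
  have : Finite (V ⧸ A) := Finite.of_surjective _ A.mkQ_surjective
  have h1 := card_tuples_eq s (fun I : Submodule F V => Disjoint I A)
  have h2 : (Nat.card {v : Fin s → V // LinearIndependent F v ∧
      Disjoint (span F (Set.range v)) A} : ℚ) =
      Nat.card {w : Fin s → V ⧸ A // LinearIndependent F w} *
        ((Fintype.card F : ℚ) ^ (finrank F A * s)) := by
    -- A tuple is independent with span disjoint from `A` exactly when its image in `V ⧸ A` is
    -- independent, and each image tuple has `|A| ^ s` lifts.
    refine card_subtype_eq_card_mul (fun v => A.mkQ ∘ v) _ (fun v hv => ?_) fun w hw => ?_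
    · rw [linearIndependent_comp_iff, ker_mkQ]
      exact hv
    · have hA : (Fintype.card F) ^ (finrank F A * s) = Nat.card A ^ s := by
        rw [Module.natCard_eq_pow_finrank (K := F) (V := A), pow_mul, Nat.card_eq_fintype_card]
      have hset : ∀ v : Fin s → V, ((LinearIndependent F v ∧
          Disjoint (span F (Set.range v)) A) ∧ A.mkQ ∘ v = w) ↔ A.mkQ ∘ v = w := by
        refine fun v => ⟨fun h => h.2, fun h => ⟨?_, h⟩⟩
        have := (linearIndependent_comp_iff A.mkQ v).1 (h ▸ hw)
        rwa [ker_mkQ] at this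
      rw [Nat.card_congr (Equiv.subtypeEquivRight hset), card_fiber_comp_mkQ, ← hA]
      push_cast
      rfl
  rw [h2, card_linearIndependent_rat, finrank_quotient,
    fallProd_eq_gaussBinom_mul (one_lt_card_rat F)] at h1
  refine mul_right_cancel₀ (fallProd_ne_zero (one_lt_card_rat F) s) ?_
  rw [← h1]
  ring

/-- The number of `s`-dimensional subspaces of a given subspace. -/
theorem card_le (s : ℕ) (A : Submodule F V) :
    (Nat.card {I : Submodule F V // I ≤ A ∧ finrank F I = s} : ℚ) =
      gaussBinom (Fintype.card F) (finrank F A) s := by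
  have h := card_disjoint s (⊥ : Submodule F A)
  simp only [finrank_bot, zero_mul, pow_zero, one_mul, tsub_zero, disjoint_bot_right,
    and_true] at h
  rw [← h]
  congr 1
  refine Nat.card_congr
    { toFun := fun I => ⟨comap A.subtype I.1, ?_⟩
      invFun := fun J => ⟨map A.subtype J.1, map_subtype_le _ _, ?_⟩
      left_inv := fun I => Subtype.ext ?_
      right_inv := fun J => Subtype.ext ?_ }
  · exact (comapSubtypeEquivOfLe I.2.1).finrank_eq.trans I.2.2
  · exact (finrank_map_subtype_eq _ _).trans J.2
  · simp [map_comap_subtype, I.2.1]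
  · exact comap_map_eq_of_injective A.injective_subtype _

/-- The number of `r`-dimensional subspaces of a product of two spaces that meet both
factors trivially. -/
theorem card_disjoint_prod {V' : Type*} [AddCommGroup V'] [Module F V'] [Finite V'] (r : ℕ) :
    (Nat.card {I : Submodule F (V × V') // finrank F I = r ∧
      Disjoint I (LinearMap.ker (LinearMap.fst F V V')) ∧
      Disjoint I (LinearMap.ker (LinearMap.snd F V V'))} : ℚ) =
      gaussBinom (Fintype.card F) (finrank F V) r * gaussBinom (Fintype.card F) (finrank F V') r *
        fallProd (Fintype.card F) r r := by
  have h1 := card_tuples_eq r (fun I : Submodule F (V × V') =>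
    Disjoint I (LinearMap.ker (LinearMap.fst F V V')) ∧
      Disjoint I (LinearMap.ker (LinearMap.snd F V V')))
  -- Such tuples of pairs are arbitrary pairs of independent tuples: avoiding both kernels forces
  -- each coordinate tuple to be independent.
  have h2 : Nat.card {v : Fin r → V × V' // LinearIndependent F v ∧
      Disjoint (span F (Set.range v)) (LinearMap.ker (LinearMap.fst F V V')) ∧
      Disjoint (span F (Set.range v)) (LinearMap.ker (LinearMap.snd F V V'))} =
      Nat.card {w : Fin r → V // LinearIndependent F w} *
        Nat.card {w : Fin r → V' // LinearIndependent F w} := by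
    rw [← Nat.card_prod]
    refine Nat.card_congr
      { toFun := fun v => (⟨LinearMap.fst F V V' ∘ v.1, ?_⟩, ⟨LinearMap.snd F V V' ∘ v.1, ?_⟩)
        invFun := fun w => ⟨fun j => (w.1.1 j, w.2.1 j), ?_⟩
        left_inv := fun v => rfl
        right_inv := fun w => rfl }
    · exact (linearIndependent_comp_iff _ _).2 ⟨v.2.1, v.2.2.1⟩
    · exact (linearIndependent_comp_iff _ _).2 ⟨v.2.1, v.2.2.2⟩
    · have e1 := (linearIndependent_comp_iff (LinearMap.fst F V V')
        (fun j => (w.1.1 j, w.2.1 j))).1 w.1.2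
      have e2 := (linearIndependent_comp_iff (LinearMap.snd F V V')
        (fun j => (w.1.1 j, w.2.1 j))).1 w.2.2
      exact ⟨e1.1, e1.2, e2.2⟩
  rw [h2, Nat.cast_mul, card_linearIndependent_rat, card_linearIndependent_rat,
    fallProd_eq_gaussBinom_mul (one_lt_card_rat F) (finrank F V),
    fallProd_eq_gaussBinom_mul (one_lt_card_rat F) (finrank F V')] at h1
  refine mul_right_cancel₀ (fallProd_ne_zero (one_lt_card_rat F) r) ?_
  rw [← h1]
  ring

theorem disjoint_comap_of_disjoint_map {F V V' : Type*} [Field F] [AddCommGroup V] [Module F V]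
    [AddCommGroup V'] [Module F V'] {f : V →ₗ[F] V'} (hf : Function.Injective f)
    {I : Submodule F V'} {J : Submodule F V} (h : Disjoint I (map f J)) :
    Disjoint (comap f I) J := by
  rw [disjoint_def] at h ⊢
  exact fun x hx hJ => (map_eq_zero_iff f hf).1 (h _ hx (mem_map_of_mem hJ))

/-- The number of `r`-dimensional subspaces of `A ⊔ B` that meet `A` and `B` trivially, for
disjoint `A` and `B`. -/
theorem card_le_sup_disjoint {A B : Submodule F V} (hAB : Disjoint A B) (r : ℕ) :
    (Nat.card {I : Submodule F V // finrank F I = r ∧ I ≤ A ⊔ B ∧ Disjoint I A ∧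
      Disjoint I B} : ℚ) =
      gaussBinom (Fintype.card F) (finrank F A) r * gaussBinom (Fintype.card F) (finrank F B) r *
        fallProd (Fintype.card F) r r := by
  rw [← card_disjoint_prod]
  set h : A × B →ₗ[F] V := A.subtype.coprod B.subtype with hh
  have hinj : Function.Injective h := by
    rw [← LinearMap.ker_eq_bot, hh, LinearMap.ker_coprod_of_disjoint_range] <;> simp [hAB]
  have hrange : LinearMap.range h = A ⊔ B := by simp [hh, LinearMap.range_coprod]
  have hA : map h (LinearMap.ker (LinearMap.snd F A B)) = A := by
    rw [LinearMap.ker_snd, ← LinearMap.range_comp, hh, LinearMap.coprod_inl, range_subtype]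
  have hB : map h (LinearMap.ker (LinearMap.fst F A B)) = B := by
    rw [LinearMap.ker_fst, ← LinearMap.range_comp, hh, LinearMap.coprod_inr, range_subtype]
  have hcm : ∀ J : Submodule F (A × B), comap h (map h J) = J :=
    fun J => comap_map_eq_of_injective hinj J
  have hmc : ∀ I : Submodule F V, I ≤ A ⊔ B → map h (comap h I) = I := fun I hI => by
    rw [map_comap_eq, hrange, inf_eq_right.2 hI]
  congr 1
  refine Nat.card_congr
    { toFun := fun I => ⟨comap h I.1, ?_, disjoint_comap_of_disjoint_map hinj ?_,
        disjoint_comap_of_disjoint_map hinj ?_⟩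
      invFun := fun J => ⟨map h J.1,
        (equivMapOfInjective h hinj J.1).finrank_eq.symm.trans J.2.1,
        LinearMap.map_le_range.trans hrange.le, ?_, ?_⟩
      left_inv := fun I => Subtype.ext (hmc _ I.2.2.1)
      right_inv := fun J => Subtype.ext (hcm _) }
  · refine Eq.trans ?_ I.2.1
    rw [(equivMapOfInjective h hinj _).finrank_eq, hmc _ I.2.2.1]
  · rw [hB]
    exact I.2.2.2.2
  · rw [hA]
    exact I.2.2.2.1
  · have := disjoint_map hinj J.2.2.2
    rwa [hA] at this
  · have := disjoint_map hinj J.2.2.1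
    rwa [hB] at this

/-- The subspaces `I ≥ D` correspond to the subspaces of `V ⧸ D`. -/
theorem card_ge_eq_card_quotient {F V : Type*} [Field F] [AddCommGroup V] [Module F V] (D : Submodule F V) (P : Submodule F V → Prop)
    (Q : Submodule F (V ⧸ D) → Prop) (h : ∀ I, D ≤ I → (P I ↔ Q (map D.mkQ I))) :
    Nat.card {I : Submodule F V // D ≤ I ∧ P I} = Nat.card {I : Submodule F (V ⧸ D) // Q I} := by
  have hc : ∀ I : Submodule F (V ⧸ D), map D.mkQ (comap D.mkQ I) = I := fun I =>
    map_comap_eq_of_surjective D.mkQ_surjective I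
  have hm : ∀ I : Submodule F V, D ≤ I → comap D.mkQ (map D.mkQ I) = I := fun I hI => by
    rw [comap_map_mkQ, sup_eq_right.2 hI]
  exact Nat.card_congr
    { toFun := fun I => ⟨map D.mkQ I.1, (h _ I.2.1).1 I.2.2⟩
      invFun := fun I => ⟨comap D.mkQ I.1, le_comap_mkQ _ _,
        (h _ (le_comap_mkQ _ _)).2 (by rw [hc]; exact I.2)⟩
      left_inv := fun I => Subtype.ext (hm _ I.2.1)
      right_inv := fun I => Subtype.ext (hc _) }

theorem finrank_map_mkQ_add {F V : Type*} [Field F] [AddCommGroup V] [Module F V] [Finite V]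
    {D I : Submodule F V} :
    finrank F (map D.mkQ I) + finrank F (I ⊓ D : Submodule F V) = finrank F I := by
  have h := (D.mkQ.domRestrict I).finrank_range_add_finrank_ker
  rw [LinearMap.range_domRestrict, LinearMap.ker_domRestrict, ker_mkQ] at h
  rw [← h, ← finrank_map_subtype_eq I (comap I.subtype D), map_comap_subtype]

theorem disjoint_map_mkQ_iff {F V : Type*} [Field F] [AddCommGroup V] [Module F V] {D I A : Submodule F V} (h : D ≤ I) :
    Disjoint (map D.mkQ I) (map D.mkQ A) ↔ I ⊓ A ≤ D := by
  rw [disjoint_iff, ← (comap_injective_of_surjective D.mkQ_surjective).eq_iff, comap_inf,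
    comap_map_mkQ, comap_map_mkQ, comap_bot, ker_mkQ, sup_eq_right.2 h]
  constructor
  · intro e
    exact (inf_le_inf_left I le_sup_right).trans e.le
  · intro e
    refine le_antisymm ?_ (le_inf h le_sup_left)
    rw [inf_comm, sup_inf_assoc_of_le _ h, inf_comm]
    exact sup_le le_rfl e

/-- The number of `s`-dimensional subspaces that meet each of two disjoint subspaces of
dimensions `a` and `b` trivially. -/
def disjointFormula (q : ℚ) (n a b s : ℕ) : ℚ :=
  ∑ r ∈ Finset.range (s + 1), gaussBinom q a r * gaussBinom q b r * fallProd q r r *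
    (q ^ ((a + b - r) * (s - r)) * gaussBinom q (n - r - (a + b - r)) (s - r))

/-- The subspaces are sorted by `R = I ∩ (A ⊕ B)`, which meets `A` and `B` trivially. Modulo `R`,
the only condition left on `I` is to avoid the image of `A ⊕ B`, and `card_disjoint` applies. -/
theorem card_disjoint_disjoint {A B : Submodule F V} (hAB : Disjoint A B) (s : ℕ) :
    (Nat.card {I : Submodule F V // finrank F I = s ∧ Disjoint I A ∧ Disjoint I B} : ℚ) =
      disjointFormula (Fintype.card F) (finrank F V) (finrank F A) (finrank F B) s := by
  have hW : finrank F (A ⊔ B : Submodule F V) = finrank F A + finrank F B := by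
    rw [← finrank_sup_add_finrank_inf_eq, hAB.eq_bot, finrank_bot, add_zero]
  rw [card_subtype_eq_sum_fiber (fun I => finrank F (I ⊓ (A ⊔ B) : Submodule F V))
    (Finset.range (s + 1)), Nat.cast_sum, disjointFormula]
  swap
  · intro I hI
    rw [Finset.mem_range, Nat.lt_succ_iff, ← hI.1]
    exact finrank_mono inf_le_left
  refine Finset.sum_congr rfl fun r hr => ?_
  have hr : r ≤ s := by simpa [Nat.lt_succ_iff] using hr
  rw [← card_le_sup_disjoint hAB r]
  refine card_subtype_eq_card_mul (fun I => I ⊓ (A ⊔ B)) _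
    (fun I hI => ⟨hI.2, inf_le_right, hI.1.2.1.mono_left inf_le_left,
      hI.1.2.2.mono_left inf_le_left⟩) fun R hR => ?_
  have : Finite (V ⧸ R) := Finite.of_surjective _ R.mkQ_surjective
  have h1 : Nat.card {I : Submodule F V // ((finrank F I = s ∧ Disjoint I A ∧ Disjoint I B) ∧
      finrank F (I ⊓ (A ⊔ B) : Submodule F V) = r) ∧ I ⊓ (A ⊔ B) = R} =
      Nat.card {I : Submodule F V // R ≤ I ∧ finrank F I = s ∧ I ⊓ (A ⊔ B) ≤ R} := by
    refine Nat.card_congr (Equiv.subtypeEquivRight fun I => ⟨fun h => ?_, fun h => ?_⟩)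
    · exact ⟨h.2 ▸ inf_le_left, h.1.1.1, h.2.le⟩
    · have e : I ⊓ (A ⊔ B) = R := le_antisymm h.2.2 (le_inf h.1 hR.2.1)
      refine ⟨⟨⟨h.2.1, ?_, ?_⟩, by rw [e, hR.1]⟩, e⟩
      · have := hR.2.2.1
        rw [← e, disjoint_iff, inf_assoc, inf_eq_right.2 (le_sup_left : A ≤ A ⊔ B)] at this
        exact disjoint_iff.2 this
      · have := hR.2.2.2
        rw [← e, disjoint_iff, inf_assoc, inf_eq_right.2 (le_sup_right : B ≤ A ⊔ B)] at this
        exact disjoint_iff.2 this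
  have hWR : finrank F (map R.mkQ (A ⊔ B)) = finrank F A + finrank F B - r := by
    have := finrank_map_mkQ_add (D := R) (I := A ⊔ B)
    rw [inf_eq_right.2 hR.2.1, hR.1, hW] at this
    omega
  have hVR : finrank F (V ⧸ R) = finrank F V - r := by rw [finrank_quotient, hR.1]
  rw [h1, card_ge_eq_card_quotient R _
    (fun I => finrank F I = s - r ∧ Disjoint I (map R.mkQ (A ⊔ B))), card_disjoint, hWR, hVR]
  intro I hI
  rw [disjoint_map_mkQ_iff hI]
  have := finrank_map_mkQ_add (D := R) (I := I)
  rw [inf_eq_right.2 hI, hR.1] at this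
  refine and_congr_left fun _ => by omega

/-- Modulo `D = J ⊕ S` the two conditions become disjointness from the images of `A` and `B`. By the
modular law `D ∩ A = J` and `D ∩ B = S`, and the two images are again disjoint. -/
theorem card_inf_eq_inf_eq {A B J S : Submodule F V} (hAB : Disjoint A B) (hJ : J ≤ A)
    (hS : S ≤ B) {s : ℕ} (hs : finrank F J + finrank F S ≤ s) :
    (Nat.card {I : Submodule F V // finrank F I = s ∧ I ⊓ A = J ∧ I ⊓ B = S} : ℚ) =
      disjointFormula (Fintype.card F) (finrank F V - (finrank F J + finrank F S))
        (finrank F A - finrank F J) (finrank F B - finrank F S)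
        (s - (finrank F J + finrank F S)) := by
  set D := J ⊔ S with hD
  have : Finite (V ⧸ D) := Finite.of_surjective _ D.mkQ_surjective
  have hJS : Disjoint J S := hAB.mono hJ hS
  have hdD : finrank F D = finrank F J + finrank F S := by
    rw [← finrank_sup_add_finrank_inf_eq, hJS.eq_bot, finrank_bot, add_zero]
  have hDA : D ⊓ A = J := by
    rw [hD, sup_inf_assoc_of_le _ hJ, (hAB.symm.mono_left hS).eq_bot, sup_bot_eq]
  have hDB : D ⊓ B = S := by
    rw [hD, sup_comm, sup_inf_assoc_of_le _ hS, (hAB.mono_left hJ).eq_bot, sup_bot_eq]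
  have hAD := finrank_map_mkQ_add (D := D) (I := A)
  have hBD := finrank_map_mkQ_add (D := D) (I := B)
  rw [inf_comm, hDA] at hAD
  rw [inf_comm, hDB] at hBD
  have hdisj : Disjoint (map D.mkQ A) (map D.mkQ B) := by
    have : map D.mkQ A = map D.mkQ (A ⊔ D) := by rw [Submodule.map_sup, mkQ_map_self, sup_bot_eq]
    rw [this, disjoint_map_mkQ_iff le_sup_right, hD, ← sup_assoc, sup_eq_left.2 hJ, sup_comm,
      sup_inf_assoc_of_le _ hS, hAB.eq_bot, sup_bot_eq]
    exact le_sup_right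
  have h1 : Nat.card {I : Submodule F V // finrank F I = s ∧ I ⊓ A = J ∧ I ⊓ B = S} =
      Nat.card {I : Submodule F V // D ≤ I ∧ finrank F I = s ∧ I ⊓ A ≤ D ∧ I ⊓ B ≤ D} := by
    refine Nat.card_congr (Equiv.subtypeEquivRight fun I => ⟨fun h => ?_, fun h => ?_⟩)
    · exact ⟨sup_le (h.2.1 ▸ inf_le_left) (h.2.2 ▸ inf_le_left), h.1,
        h.2.1.le.trans le_sup_left, h.2.2.le.trans le_sup_right⟩
    · refine ⟨h.2.1, ?_, ?_⟩
      · exact le_antisymm (hDA ▸ le_inf h.2.2.1 inf_le_right) (le_inf (le_sup_left.trans h.1) hJ)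
      · exact le_antisymm (hDB ▸ le_inf h.2.2.2 inf_le_right) (le_inf (le_sup_right.trans h.1) hS)
  rw [h1, card_ge_eq_card_quotient D _ (fun I => finrank F I = s - finrank F D ∧
    Disjoint I (map D.mkQ A) ∧ Disjoint I (map D.mkQ B)), card_disjoint_disjoint hdisj,
    finrank_quotient, hdD]
  · congr 1 <;> omega
  · intro I hI
    rw [disjoint_map_mkQ_iff hI, disjoint_map_mkQ_iff hI]
    have := finrank_map_mkQ_add (D := D) (I := I)
    rw [inf_eq_right.2 hI] at this
    refine and_congr_left fun _ => by omega

end Counting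

/-! ### The number of subspaces with given dimension of collapse -/

section Counting

open Module Submodule

theorem disjointFormula_eq {d l m i j : ℕ} (q : ℚ) (hij : i ≤ j) (hjl : j ≤ l)
    (hm : j + i ≤ m) :
    disjointFormula q (d - (j + i)) (l - j) (j - i) (m - (j + i)) =
      ∑ r ∈ (Finset.range (l + 1)).filter (fun r => j + r ≤ l ∧ i + r ≤ j ∧ i + j + r ≤ m),
      q ^ ((l - i - r) * (m - j - i - r)) *
        gaussBinom q (l - j) r * gaussBinom q (j - i) r * gaussBinom q (d - l - j) (m - j - i - r) *
        ∏ e ∈ Finset.range r, (q ^ r - q ^ e) := by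
  symm
  rw [disjointFormula]
  refine Finset.sum_subset_zero_on_sdiff (fun r hr => ?_) (fun r hr => ?_) fun r hr => ?_
  · simp only [Finset.mem_filter, Finset.mem_range] at hr ⊢
    omega
  -- The additional values of `r` exceed `l - j` or `j - i`, so a Gaussian binomial vanishes.
  · simp only [Finset.mem_sdiff, Finset.mem_filter, Finset.mem_range] at hr
    rcases lt_or_ge (l - j) r with h | h
    · rw [gaussBinom, if_neg (by omega)]
      simp
    · rw [gaussBinom.eq_1 q (j - i), if_neg (by omega)]
      simp
  · simp only [Finset.mem_filter, Finset.mem_range] at hr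
    rw [show l - j + (j - i) - r = l - i - r by omega, show m - (j + i) - r = m - j - i - r by omega,
      show d - (j + i) - r - (l - i - r) = d - l - j by omega, fallProd]
    ring

variable {F V E : Type*} [Field F] [Fintype F] [AddCommGroup V] [Module F V] [Finite V]
  [AddCommGroup E] [Module F E]

/-- The number of `m`-dimensional subspaces `I` with `dim (f I ∩ g I) = i`, for two injective
linear maps `f` and `g` such that no nonzero vector is mapped into the other range by both. -/
theorem card_finrank_map_inf_map {f g : V →ₗ[F] E} (hf : Function.Injective f)
    (hg : Function.Injective g)
    (hfg : Disjoint (comap f (LinearMap.range g)) (comap g (LinearMap.range f))) (m i : ℕ) :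
    (Nat.card {I : Submodule F V // finrank F I = m ∧
      finrank F (map f I ⊓ map g I : Submodule F E) = i} : ℚ) =
      colFormula (finrank F V) (finrank F (map f ⊤ ⊓ map g ⊤ : Submodule F E)) m i
        (Fintype.card F) := by
  rw [Submodule.map_top, Submodule.map_top]
  set U := comap f (LinearMap.range g) with hU
  set l := finrank F (LinearMap.range f ⊓ LinearMap.range g : Submodule F E) with hl
  have hlU : finrank F U = l := by
    rw [(equivMapOfInjective f hf U).finrank_eq, hU, map_comap_eq]
  set σ : Submodule F V → Submodule F V := fun J => comap g (map f J) with hσ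
  have hσd : ∀ J ≤ U, finrank F (σ J) = finrank F J := fun J hJ => by
    rw [(equivMapOfInjective g hg _).finrank_eq, hσ, map_comap_eq, inf_eq_right.2,
      (equivMapOfInjective f hf J).finrank_eq]
    exact (map_mono hJ).trans (map_comap_le _ _)
  -- If `g x = f u`, then `u` lies in `U` automatically.
  have hσI : ∀ I : Submodule F V, I ⊓ σ (I ⊓ U) = I ⊓ σ I := fun I => by
    refine le_antisymm (inf_le_inf_left I (comap_mono (map_mono inf_le_left))) ?_
    rintro x ⟨hx, hx'⟩
    obtain ⟨u, hu, hux⟩ := mem_map.1 (mem_comap.1 hx')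
    exact ⟨hx, mem_comap.2 (mem_map.2 ⟨u, ⟨hu, mem_comap.2 ⟨x, hux.symm⟩⟩, hux⟩)⟩
  have hcol : ∀ I : Submodule F V, finrank F (map f I ⊓ map g I : Submodule F E) =
      finrank F (I ⊓ σ (I ⊓ U) : Submodule F V) := fun I => by
    rw [hσI, (equivMapOfInjective g hg _).finrank_eq, Submodule.map_inf g hg, hσ, map_comap_eq, inf_left_comm,
      ← inf_assoc, inf_eq_right.2 LinearMap.map_le_range, inf_comm]
  rw [card_subtype_eq_sum_fiber (fun I => finrank F (I ⊓ U : Submodule F V))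
    (Finset.Icc i l), Nat.cast_sum, colFormula]
  swap
  · rintro I ⟨-, rfl⟩
    rw [Finset.mem_Icc, hcol, ← hσd _ inf_le_right, ← hlU]
    exact ⟨finrank_mono inf_le_right, by rw [hσd _ inf_le_right]; exact finrank_mono inf_le_right⟩
  refine Finset.sum_congr rfl fun j hj => ?_
  obtain ⟨hij, hjl⟩ := Finset.mem_Icc.1 hj
  rw [← hlU, ← card_le j U, mul_assoc]
  refine card_subtype_eq_card_mul (fun I => I ⊓ U) _ (fun I hI => ⟨inf_le_right, hI.2⟩)
    fun J hJ => ?_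
  rw [hlU]
  have hσJ : finrank F (σ J) = j := (hσd J hJ.1).trans hJ.2
  -- The factor `gaussBinom q j i` counts the possible `S = I ∩ σ J` inside the `j`-dimensional
  -- space `σ J`.
  conv_rhs => rw [← hσJ, ← card_le i (σ J), hσJ]
  refine card_subtype_eq_card_mul (fun I => I ⊓ σ J) _ ?_ fun S hS => ?_
  · rintro I ⟨⟨⟨hI, hI'⟩, -⟩, rfl⟩
    exact ⟨inf_le_right, (hcol I).symm.trans hI'⟩
  have h1 : Nat.card {I : Submodule F V // (((finrank F I = m ∧
      finrank F (map f I ⊓ map g I : Submodule F E) = i) ∧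
      finrank F (I ⊓ U : Submodule F V) = j) ∧ I ⊓ U = J) ∧ I ⊓ σ J = S} =
      Nat.card {I : Submodule F V // finrank F I = m ∧ I ⊓ U = J ∧ I ⊓ σ J = S} := by
    refine Nat.card_congr (Equiv.subtypeEquivRight fun I => ⟨fun h => ?_, fun h => ?_⟩)
    · exact ⟨h.1.1.1.1, h.1.2, h.2⟩
    · refine ⟨⟨⟨⟨h.1, ?_⟩, by rw [h.2.1, hJ.2]⟩, h.2.1⟩, h.2.2⟩
      rw [hcol, h.2.1, h.2.2, hS.2]
  have hUσ : Disjoint U (σ J) := hfg.mono_right (comap_mono LinearMap.map_le_range)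
  rw [h1]
  rcases le_or_gt (j + i) m with hm | hm
  · rw [card_inf_eq_inf_eq hUσ hJ.1 hS.1 (by rw [hJ.2, hS.2]; exact hm), hJ.2, hS.2, hlU, hσJ,
      disjointFormula_eq _ hij hjl hm]
  -- Since `I` contains `J ⊕ S`, of dimension `j + i > m`, no such `I` exists; the inner sum is
  -- empty as well.
  · have : IsEmpty {I : Submodule F V // finrank F I = m ∧ I ⊓ U = J ∧ I ⊓ σ J = S} := by
      refine ⟨fun ⟨I, hI, hIJ, hIS⟩ => hm.not_ge ?_⟩
      have hJS : Disjoint J S := hUσ.mono hJ.1 hS.1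
      rw [← hJ.2, ← hS.2, ← finrank_sup_add_finrank_inf_eq, hJS.eq_bot, finrank_bot, add_zero, ← hI]
      exact finrank_mono (sup_le (hIJ ▸ inf_le_left) (hIS ▸ inf_le_left))
    rw [Nat.card_of_isEmpty, Nat.cast_zero, Finset.filter_false_of_mem, Finset.sum_empty]
    intro r _
    omega

end Counting

/-! ### Polynomiality of the counting formula -/

section Poly

/-- The Gaussian binomial coefficient as a polynomial, by the `q`-Pascal rule. -/
noncomputable def gaussPoly : ℕ → ℕ → ℤ[X]
  | _, 0 => 1
  | 0, _ + 1 => 0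
  | n + 1, s + 1 => gaussPoly n s + X ^ (s + 1) * gaussPoly n (s + 1)

theorem fallProd_succ_succ (q : ℚ) (n s : ℕ) :
    fallProd q (n + 1) (s + 1) = (q ^ (n + 1) - 1) * q ^ s * fallProd q n s := by
  rw [fallProd, Finset.prod_range_succ', fallProd, pow_zero, mul_comm, mul_assoc]
  congr 1
  conv_rhs => rw [← Finset.card_range s, ← Finset.prod_const, Finset.card_range,
    ← Finset.prod_mul_distrib]
  exact Finset.prod_congr rfl fun e _ => by ring

theorem gaussBinom_succ_succ {q : ℚ} (hq : 1 < q) (n s : ℕ) :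
    gaussBinom q (n + 1) (s + 1) = gaussBinom q n s + q ^ (s + 1) * gaussBinom q n (s + 1) := by
  refine mul_right_cancel₀ (fallProd_ne_zero hq (s + 1)) ?_
  have h1 := fallProd_eq_gaussBinom_mul hq n s
  have h2 := fallProd_eq_gaussBinom_mul hq n (s + 1)
  have h3 : fallProd q n (s + 1) = fallProd q n s * (q ^ n - q ^ s) := Finset.prod_range_succ _ _
  rw [add_mul, mul_assoc, ← h2, ← fallProd_eq_gaussBinom_mul hq, fallProd_succ_succ,
    fallProd_succ_succ q s s, h3]
  linear_combination (q ^ (s + 1) - 1) * q ^ s * h1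

theorem eval_gaussPoly {q : ℤ} (hq : 1 < q) (n s : ℕ) :
    (((gaussPoly n s).eval q : ℤ) : ℚ) = gaussBinom q n s := by
  have hq' : (1 : ℚ) < q := by exact_mod_cast hq
  induction n generalizing s with
  | zero =>
    cases s with
    | zero => simp [gaussPoly, gaussBinom]
    | succ s => simp [gaussPoly, gaussBinom]
  | succ n ih =>
    cases s with
    | zero => simp [gaussPoly, gaussBinom]
    | succ s =>
      rw [gaussBinom_succ_succ hq', ← ih, ← ih, gaussPoly]
      simp

/-- The explicit counting formula as a polynomial. -/
noncomputable def colPoly (d l m i : ℕ) : ℤ[X] :=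
  ∑ j ∈ Finset.Icc i l, gaussPoly l j * gaussPoly j i *
    ∑ r ∈ (Finset.range (l + 1)).filter (fun r => j + r ≤ l ∧ i + r ≤ j ∧ i + j + r ≤ m),
      X ^ ((l - i - r) * (m - j - i - r)) *
        gaussPoly (l - j) r * gaussPoly (j - i) r * gaussPoly (d - l - j) (m - j - i - r) *
        ∏ e ∈ Finset.range r, (X ^ r - X ^ e)

theorem eval_colPoly {q : ℤ} (hq : 1 < q) (d l m i : ℕ) :
    (((colPoly d l m i).eval q : ℤ) : ℚ) = colFormula d l m i q := by
  simp [colPoly, colFormula, eval_finsetSum, eval_prod, eval_gaussPoly hq]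

end Poly

/-! ### Words, coefficients and grading in the free associative algebra -/

section Words

variable (K : Type) [Field K]

/-- The word `w` as an element of the free associative algebra. -/
noncomputable def word (w : List (Fin 2)) : FreeAlgebra K (Fin 2) :=
  (w.map (FreeAlgebra.ι K)).prod

/-- The coefficient of the word `w`. -/
noncomputable def wcoeff (w : List (Fin 2)) : FreeAlgebra K (Fin 2) →ₗ[K] K :=
  (FreeAlgebra.basisFreeMonoid K (Fin 2)).coord (FreeMonoid.ofList w)

theorem basisFreeMonoid_ofList (w : List (Fin 2)) :
    FreeAlgebra.basisFreeMonoid K (Fin 2) (FreeMonoid.ofList w) = word K w := by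
  have h : FreeAlgebra.basisFreeMonoid K (Fin 2) (FreeMonoid.ofList w) =
      MonoidAlgebra.lift K (FreeAlgebra K (Fin 2)) (FreeMonoid (Fin 2))
        (FreeMonoid.lift (FreeAlgebra.ι K)) (MonoidAlgebra.single (FreeMonoid.ofList w) 1) := by
    simp only [FreeAlgebra.basisFreeMonoid, Module.Basis.map_apply, Finsupp.coe_basisSingleOne]
    rfl
  rw [h, MonoidAlgebra.lift_single, one_smul, FreeMonoid.lift_apply]
  rfl

variable {K}

theorem word_singleton (i : Fin 2) : word K [i] = FreeAlgebra.ι K i := by simp [word]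

theorem word_cons (i : Fin 2) (w : List (Fin 2)) :
    word K (i :: w) = FreeAlgebra.ι K i * word K w := by simp [word]

theorem word_append (v w : List (Fin 2)) : word K (v ++ w) = word K v * word K w := by
  simp [word]

theorem wcoeff_word (z w : List (Fin 2)) : wcoeff K z (word K w) = if w = z then 1 else 0 := by
  classical
  rw [← basisFreeMonoid_ofList, wcoeff, Module.Basis.coord_apply, Module.Basis.repr_self,
    Finsupp.single_apply]
  exact if_congr FreeMonoid.ofList.injective.eq_iff rfl rfl

theorem word_induction {p : FreeAlgebra K (Fin 2) → Prop} (hw : ∀ w, p (word K w))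
    (hadd : ∀ a b, p a → p b → p (a + b)) (hsmul : ∀ (c : K) a, p a → p (c • a))
    (a : FreeAlgebra K (Fin 2)) : p a := by
  have ha := (FreeAlgebra.basisFreeMonoid K (Fin 2)).mem_span a
  induction ha using Submodule.span_induction with
  | mem x hx =>
    obtain ⟨w, rfl⟩ := hx
    have := basisFreeMonoid_ofList K (FreeMonoid.toList w)
    rw [FreeMonoid.ofList_toList] at this
    exact this ▸ hw _
  | zero => simpa using hsmul 0 _ (hw [])
  | add a b _ _ ha hb => exact hadd a b ha hb
  | smul c a _ ha => exact hsmul c a ha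

theorem wcoeff_ext {a b : FreeAlgebra K (Fin 2)} (h : ∀ z, wcoeff K z a = wcoeff K z b) :
    a = b :=
  (FreeAlgebra.basisFreeMonoid K (Fin 2)).ext_elem fun w => h (FreeMonoid.toList w)

theorem wcoeff_ι_mul (i : Fin 2) (z : List (Fin 2)) (a : FreeAlgebra K (Fin 2)) :
    wcoeff K z (FreeAlgebra.ι K i * a) = if z.head? = some i then wcoeff K z.tail a else 0 := by
  induction a using word_induction with
  | hw w =>
    rw [← word_cons, wcoeff_word, wcoeff_word]
    cases z with
    | nil => simp
    | cons j z => by_cases h : j = i <;> simp [h, eq_comm (a := i)]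
  | hadd a b ha hb => rw [mul_add, map_add, ha, hb]; split_ifs <;> simp
  | hsmul c a ha => rw [mul_smul_comm, map_smul, ha]; split_ifs <;> simp

theorem wcoeff_mul_ι (i : Fin 2) (z : List (Fin 2)) (a : FreeAlgebra K (Fin 2)) :
    wcoeff K z (a * FreeAlgebra.ι K i) =
      if z.getLast? = some i then wcoeff K z.dropLast a else 0 := by
  induction a using word_induction with
  | hw w =>
    rw [← word_singleton, ← word_append, wcoeff_word, wcoeff_word]
    rcases List.eq_nil_or_concat z with rfl | ⟨z, j, rfl⟩
    · simp
    · by_cases h : j = i <;> simp [h, eq_comm (a := i)]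
  | hadd a b ha hb => rw [add_mul, map_add, ha, hb]; split_ifs <;> simp
  | hsmul c a ha => rw [smul_mul_assoc, map_smul, ha]; split_ifs <;> simp

theorem word_mem_wordSpan (w : List (Fin 2)) : word K w ∈ wordSpan K w.length :=
  Submodule.subset_span ⟨w, rfl, rfl⟩

theorem wcoeff_eq_zero_of_mem_wordSpan {n : ℕ} {a : FreeAlgebra K (Fin 2)}
    (ha : a ∈ wordSpan K n) {z : List (Fin 2)} (hz : z.length ≠ n) : wcoeff K z a = 0 := by
  have : wordSpan K n ≤ LinearMap.ker (wcoeff K z) := by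
    refine Submodule.span_le.2 ?_
    rintro _ ⟨w, hw, rfl⟩
    change wcoeff K z (word K w) = 0
    rw [wcoeff_word, if_neg]
    rintro rfl
    exact hz hw
  exact this ha

theorem mul_mem_wordSpan {m n : ℕ} {a b : FreeAlgebra K (Fin 2)} (ha : a ∈ wordSpan K m)
    (hb : b ∈ wordSpan K n) : a * b ∈ wordSpan K (m + n) := by
  have := Submodule.mul_mem_mul ha hb
  rw [wordSpan, wordSpan, Submodule.span_mul_span] at this
  refine Submodule.span_mono ?_ this
  rintro _ ⟨_, ⟨v, hv, rfl⟩, _, ⟨w, hw, rfl⟩, rfl⟩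
  exact ⟨v ++ w, by simp [hv, hw], by simp⟩

theorem ι_mem_wordSpan (i : Fin 2) : FreeAlgebra.ι K i ∈ wordSpan K 1 := by
  rw [← word_singleton]
  exact word_mem_wordSpan [i]

theorem lie_mem_wordSpan {m n : ℕ} {a b : FreeAlgebra K (Fin 2)} (ha : a ∈ wordSpan K m)
    (hb : b ∈ wordSpan K n) : ⁅a, b⁆ ∈ wordSpan K (m + n) := by
  rw [Ring.lie_def]
  exact sub_mem (mul_mem_wordSpan ha hb) (add_comm n m ▸ mul_mem_wordSpan hb ha)

variable (K) in
/-- The projection onto the homogeneous component of degree `n`. -/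
noncomputable def homProj (n : ℕ) : FreeAlgebra K (Fin 2) →ₗ[K] FreeAlgebra K (Fin 2) :=
  (FreeAlgebra.basisFreeMonoid K (Fin 2)).constr K
    fun w => if (FreeMonoid.toList w).length = n then word K (FreeMonoid.toList w) else 0

theorem homProj_word (n : ℕ) (w : List (Fin 2)) :
    homProj K n (word K w) = if w.length = n then word K w else 0 := by
  have := (FreeAlgebra.basisFreeMonoid K (Fin 2)).constr_basis K
    (fun w => if (FreeMonoid.toList w).length = n then word K (FreeMonoid.toList w) else 0)
    (FreeMonoid.ofList w)
  rwa [basisFreeMonoid_ofList] at this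

theorem homProj_of_mem {m : ℕ} (n : ℕ) {a : FreeAlgebra K (Fin 2)} (ha : a ∈ wordSpan K m) :
    homProj K n a = if m = n then a else 0 := by
  refine Submodule.span_induction (p := fun a _ => homProj K n a = if m = n then a else 0)
    ?_ ?_ ?_ ?_ ha
  · rintro _ ⟨w, rfl, rfl⟩
    exact homProj_word n w
  · simp
  · intro a b _ _ ha hb
    rw [map_add, ha, hb]
    split_ifs <;> simp
  · intro c a _ ha
    rw [map_smul, ha]
    split_ifs <;> simp

end Words

/-! ### Homogeneous Lie polynomials and the maps `[X_i, ·]` -/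

section Nest

variable (K : Type) [Field K]

/-- The right-nested bracket of the letters of a word. -/
noncomputable def nest : List (Fin 2) → FreeAlgebra K (Fin 2)
  | [] => 0
  | [i] => FreeAlgebra.ι K i
  | i :: j :: w => ⁅FreeAlgebra.ι K i, nest (j :: w)⁆

/-- The Lie polynomials that are homogeneous of degree `n`. -/
noncomputable def lieDeg (n : ℕ) : Submodule K (FreeAlgebra K (Fin 2)) :=
  (LiePoly K).toSubmodule ⊓ wordSpan K n

variable {K}

theorem nest_cons (i : Fin 2) {w : List (Fin 2)} (hw : w ≠ []) :
    nest K (i :: w) = ⁅FreeAlgebra.ι K i, nest K w⁆ := by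
  cases w with
  | nil => exact absurd rfl hw
  | cons j w => rfl

theorem ι_mem_LiePoly (i : Fin 2) : FreeAlgebra.ι K i ∈ LiePoly K :=
  LieSubalgebra.subset_lieSpan ⟨i, rfl⟩

theorem nest_mem_lieDeg (w : List (Fin 2)) : nest K w ∈ lieDeg K w.length := by
  induction w with
  | nil => exact zero_mem _
  | cons i w ih =>
    rcases eq_or_ne w [] with rfl | hw
    · exact ⟨ι_mem_LiePoly i, ι_mem_wordSpan i⟩
    · rw [nest_cons i hw]
      refine ⟨(LiePoly K).lie_mem (ι_mem_LiePoly i) ih.1, ?_⟩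
      have := lie_mem_wordSpan (ι_mem_wordSpan i) ih.2
      rwa [add_comm] at this

/-- The span of the nested brackets is stable under each `[X_i, ·]`. By the Jacobi identity, the
elements whose bracket preserves it are closed under brackets, so it is stable under every Lie
polynomial. -/
theorem LiePoly_le_span_nest :
    (LiePoly K).toSubmodule ≤ Submodule.span K (Set.range (nest K)) := by
  set S := Submodule.span K (Set.range (nest K)) with hS
  have hι : ∀ i : Fin 2, ∀ b ∈ S, ⁅FreeAlgebra.ι K i, b⁆ ∈ S := by
    intro i b hb
    refine Submodule.span_induction (p := fun b _ => ⁅FreeAlgebra.ι K i, b⁆ ∈ S) ?_ ?_ ?_ ?_ hb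
    · rintro _ ⟨w, rfl⟩
      rcases eq_or_ne w [] with rfl | hw
      · simp [nest]
      · rw [← nest_cons i hw]
        exact Submodule.subset_span ⟨_, rfl⟩
    · simp
    · intro a b _ _ ha hb
      rw [lie_add]
      exact add_mem ha hb
    · intro c a _ ha
      rw [lie_smul]
      exact S.smul_mem c ha
  have had : ∀ a ∈ LiePoly K, ∀ b ∈ S, ⁅a, b⁆ ∈ S := by
    intro a ha
    induction ha using LieSubalgebra.lieSpan_induction with
    | mem x hx =>
      obtain ⟨i, rfl⟩ := hx
      exact hι i
    | zero => simp
    | add x y _ _ hx hy =>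
      intro b hb
      rw [add_lie]
      exact add_mem (hx b hb) (hy b hb)
    | smul c x _ hx =>
      intro b hb
      rw [smul_lie]
      exact S.smul_mem c (hx b hb)
    | lie x y _ _ hx hy =>
      intro b hb
      rw [lie_lie]
      exact sub_mem (hx _ (hy b hb)) (hy _ (hx b hb))
  intro a ha
  change a ∈ LiePoly K at ha
  induction ha using LieSubalgebra.lieSpan_induction with
  | mem x hx =>
    obtain ⟨i, rfl⟩ := hx
    exact Submodule.subset_span ⟨[i], rfl⟩
  | zero => exact zero_mem _
  | add x y _ _ hx hy => exact add_mem hx hy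
  | smul c x _ hx => exact S.smul_mem c hx
  | lie x y hx _ _ hy => exact had x hx y hy

theorem lieDeg_eq_span (n : ℕ) :
    lieDeg K n = Submodule.span K (nest K '' {w | w.length = n}) := by
  refine le_antisymm ?_ (Submodule.span_le.2 ?_)
  · rintro a ⟨ha, ha'⟩
    have h1 : homProj K n a = a := by rw [homProj_of_mem n ha', if_pos rfl]
    rw [← h1]
    have h2 := Submodule.mem_map_of_mem (f := homProj K n) (LiePoly_le_span_nest ha)
    rw [Submodule.map_span] at h2
    refine Submodule.span_le.2 ?_ h2
    rintro _ ⟨_, ⟨w, rfl⟩, rfl⟩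
    rw [homProj_of_mem n (nest_mem_lieDeg w).2]
    split_ifs with h
    · exact Submodule.subset_span ⟨w, h, rfl⟩
    · exact zero_mem _
  · rintro _ ⟨w, rfl, rfl⟩
    exact nest_mem_lieDeg w

/-- A nested bracket of length at least two is `[X_i, v]` with `v` a shorter nested bracket. Degree
one must be excluded, as the letters are not brackets. -/
theorem lieDeg_succ {n : ℕ} (hn : n ≠ 0) :
    lieDeg K (n + 1) =
      (lieDeg K n).map (LieAlgebra.ad K (FreeAlgebra K (Fin 2)) (FreeAlgebra.ι K 0)) ⊔
        (lieDeg K n).map (LieAlgebra.ad K (FreeAlgebra K (Fin 2)) (FreeAlgebra.ι K 1)) := by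
  refine le_antisymm ?_ (sup_le ?_ ?_)
  · rw [lieDeg_eq_span (n + 1), Submodule.span_le]
    rintro _ ⟨w, hw, rfl⟩
    obtain ⟨i, v, rfl⟩ : ∃ i v, w = i :: v := by
      cases w with
      | nil => simp at hw
      | cons i v => exact ⟨i, v, rfl⟩
    have hv : v.length = n := by simpa using hw
    have hv0 : v ≠ [] := by rintro rfl; exact hn hv.symm
    rw [nest_cons i hv0]
    have hmem : nest K v ∈ lieDeg K n := hv ▸ nest_mem_lieDeg v
    fin_cases i
    · exact Submodule.mem_sup_left (Submodule.mem_map_of_mem hmem)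
    · exact Submodule.mem_sup_right (Submodule.mem_map_of_mem hmem)
  all_goals
    rintro _ ⟨u, hu, rfl⟩
    exact ⟨(LiePoly K).lie_mem (ι_mem_LiePoly _) hu.1,
      add_comm n 1 ▸ lie_mem_wordSpan (ι_mem_wordSpan _) hu.2⟩

/-- The coefficients of a Lie polynomial of degree at least two sum to zero over the rotations
of a word. -/
theorem sum_wcoeff_rotate_eq_zero {n : ℕ} (hn : 2 ≤ n) {u : FreeAlgebra K (Fin 2)}
    (hu : u ∈ lieDeg K n) {z : List (Fin 2)} (hz : z.length = n) :
    ∑ r ∈ Finset.range n, wcoeff K (z.rotate r) u = 0 := by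
  have key : ∀ (i : Fin 2) (v : FreeAlgebra K (Fin 2)),
      ∑ r ∈ Finset.range n, wcoeff K (z.rotate r) ⁅FreeAlgebra.ι K i, v⁆ = 0 := by
    intro i v
    -- Rotating once moves the first letter to the end, which turns `X_i v` into `v X_i`; the sum
    -- over all rotations therefore telescopes.
    have hstep : ∀ r, wcoeff K (z.rotate r) (FreeAlgebra.ι K i * v) =
        wcoeff K (z.rotate (r + 1)) (v * FreeAlgebra.ι K i) := by
      intro r
      rw [wcoeff_ι_mul, wcoeff_mul_ι, ← List.rotate_rotate]
      have hlen : (z.rotate r).length = n := by rw [List.length_rotate, hz]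
      cases hzr : z.rotate r with
      | nil => rw [hzr] at hlen; simp at hlen; omega
      | cons j w => simp
    simp only [Ring.lie_def, map_sub, hstep]
    rw [Finset.sum_range_sub (fun r => wcoeff K (z.rotate r) (v * FreeAlgebra.ι K i))]
    rw [← hz, List.rotate_length, List.rotate_zero, sub_self]
  obtain ⟨m, rfl⟩ : ∃ m, n = m + 1 := ⟨n - 1, by omega⟩
  rw [lieDeg_succ (by omega)] at hu
  obtain ⟨_, ⟨x, _, rfl⟩, _, ⟨y, _, rfl⟩, rfl⟩ := Submodule.mem_sup.1 hu
  simp only [LieAlgebra.ad_apply, map_add, Finset.sum_add_distrib, key, add_zero]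

/-- All `n` rotations of a word have the same coefficient here, while these coefficients sum to
zero. -/
theorem eq_zero_of_cyclic {n : ℕ} (hn : 2 ≤ n) (hn0 : (n : K) ≠ 0) {u : FreeAlgebra K (Fin 2)}
    (hu : u ∈ lieDeg K n) (h : ∀ i w, wcoeff K (w ++ [i]) u = wcoeff K (i :: w) u) : u = 0 := by
  refine wcoeff_ext fun z => ?_
  rw [map_zero]
  by_cases hz : z.length = n
  · have hrot : ∀ r, wcoeff K (z.rotate r) u = wcoeff K z u := by
      intro r
      induction r with
      | zero => simp
      | succ r ih =>
        rw [← ih, ← List.rotate_rotate]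
        cases z.rotate r with
        | nil => simp
        | cons j w => simpa using h j w
    have := sum_wcoeff_rotate_eq_zero hn hu hz
    simp only [hrot, Finset.sum_const, Finset.card_range, nsmul_eq_mul] at this
    exact (mul_eq_zero.1 this).resolve_left hn0
  · exact wcoeff_eq_zero_of_mem_wordSpan hu.2 hz

/-- Every word in `X_j v - v X_j` begins or ends with `X_j`. -/
theorem wcoeff_lie_ι_of_ne {i j : Fin 2} (hij : i ≠ j) (w : List (Fin 2))
    (v : FreeAlgebra K (Fin 2)) :
    wcoeff K (i :: (w ++ [i])) ⁅FreeAlgebra.ι K j, v⁆ = 0 := by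
  have h2 : (i :: (w ++ [i])).getLast? = some i := by
    rw [← List.cons_append, List.getLast?_concat]
  rw [Ring.lie_def, map_sub, wcoeff_ι_mul, wcoeff_mul_ι, h2]
  simp [hij]

theorem wcoeff_lie_ι_self (i : Fin 2) (w : List (Fin 2)) (v : FreeAlgebra K (Fin 2)) :
    wcoeff K (i :: (w ++ [i])) ⁅FreeAlgebra.ι K i, v⁆ =
      wcoeff K (w ++ [i]) v - wcoeff K (i :: w) v := by
  have h2 : (i :: (w ++ [i])).getLast? = some i := by
    rw [← List.cons_append, List.getLast?_concat]
  have h3 : (i :: (w ++ [i])).dropLast = i :: w := by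
    rw [← List.cons_append, List.dropLast_concat]
  rw [Ring.lie_def, map_sub, wcoeff_ι_mul, wcoeff_mul_ι, h2, h3]
  simp

/-- The coefficient of `X_i w X_i` in `[X_i, u]` is the difference of those of `w X_i` and `X_i w`
in `u`. It is zero because `[X_i, u]` is also a bracket with the other letter; so `u` is cyclically
invariant. -/
theorem eq_zero_of_lie_eq_lie {n : ℕ} (hn : 2 ≤ n) (hn0 : (n : K) ≠ 0)
    {u v v' : FreeAlgebra K (Fin 2)} (hu : u ∈ lieDeg K n)
    (h0 : ⁅FreeAlgebra.ι K (0 : Fin 2), u⁆ = ⁅FreeAlgebra.ι K (1 : Fin 2), v⁆)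
    (h1 : ⁅FreeAlgebra.ι K (1 : Fin 2), u⁆ = ⁅FreeAlgebra.ι K (0 : Fin 2), v'⁆) : u = 0 := by
  refine eq_zero_of_cyclic hn hn0 hu fun i w => ?_
  rw [← sub_eq_zero, ← wcoeff_lie_ι_self]
  fin_cases i
  · exact (congrArg _ h0).trans (wcoeff_lie_ι_of_ne (by decide) w v)
  · exact (congrArg _ h1).trans (wcoeff_lie_ι_of_ne (by decide) w v')

/-- Only one of the two products in `X_i u - u X_i` contributes to the word `X_i w X_j`, and only
the other one to `X_j w X_i`. -/
theorem wcoeff_eq_zero_of_lie_eq_zero {i j : Fin 2} (hij : j ≠ i) {u : FreeAlgebra K (Fin 2)}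
    (h : ⁅FreeAlgebra.ι K i, u⁆ = 0) (w : List (Fin 2)) :
    wcoeff K (w ++ [j]) u = 0 ∧ wcoeff K (j :: w) u = 0 := by
  have h1 := congrArg (wcoeff K (i :: (w ++ [j]))) h
  have h2 := congrArg (wcoeff K (j :: (w ++ [i]))) h
  have e1 : (i :: (w ++ [j])).getLast? = some j := by
    rw [← List.cons_append, List.getLast?_concat]
  have e2 : (j :: (w ++ [i])).getLast? = some i := by
    rw [← List.cons_append, List.getLast?_concat]
  have e3 : (j :: (w ++ [i])).dropLast = j :: w := by
    rw [← List.cons_append, List.dropLast_concat]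
  rw [Ring.lie_def, map_sub, wcoeff_ι_mul, wcoeff_mul_ι, e1] at h1
  rw [Ring.lie_def, map_sub, wcoeff_ι_mul, wcoeff_mul_ι, e2, e3] at h2
  exact ⟨by simpa [hij] using h1, by simpa [hij] using h2⟩

theorem eq_zero_of_lie_eq_zero {n : ℕ} (hn : 2 ≤ n) (hn0 : (n : K) ≠ 0) (i : Fin 2)
    {u : FreeAlgebra K (Fin 2)} (hu : u ∈ lieDeg K n) (h : ⁅FreeAlgebra.ι K i, u⁆ = 0) :
    u = 0 := by
  refine eq_zero_of_cyclic hn hn0 hu fun j w => ?_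
  by_cases hij : j = i
  · subst hij
    rw [← sub_eq_zero, ← wcoeff_lie_ι_self, h, map_zero]
  · rw [(wcoeff_eq_zero_of_lie_eq_zero hij h w).1, (wcoeff_eq_zero_of_lie_eq_zero hij h w).2]

end Nest

/-! ### Ranks of integer matrices modulo a prime -/

section Rank

open Matrix

variable {m : Type*} [Fintype m] [DecidableEq m]

theorem rank_add_le' {K m : Type*} [Field K] [Fintype m] (A B : Matrix m m K) :
    (A + B).rank ≤ A.rank + B.rank := by
  rw [Matrix.rank, Matrix.rank, Matrix.rank, Matrix.mulVecLin_add]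
  exact (Submodule.finrank_mono (LinearMap.range_add_le _ _)).trans
    (Submodule.finrank_add_le_finrank_add_finrank _ _)

/-- Reduction modulo a prime does not increase the rank of an integer matrix. -/
theorem rank_map_zmod_le (p : ℕ) [Fact p.Prime] (A : Matrix m m ℤ) :
    (A.map (Int.castRingHom (ZMod p))).rank ≤ (A.map (Int.castRingHom ℚ)).rank := by
  set A' := A.map (Int.castRingHom (ZMod p)) with hA'
  obtain ⟨V, U, e, -, -, h⟩ := A'.exists_rank_normal_form
  have hlift : ∀ W : Matrix m m (ZMod p), ∃ W' : Matrix m m ℤ,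
      W'.map (Int.castRingHom (ZMod p)) = W := fun W =>
    ⟨W.map fun x => (x.val : ℤ), by ext; simp⟩
  obtain ⟨V', rfl⟩ := hlift V
  obtain ⟨U', rfl⟩ := hlift U
  -- Over `ℤ` this block lifts the identity block of the normal form. Its determinant is `1` modulo
  -- `p`, hence nonzero in `ℚ`.
  set B := (V' * A * U').submatrix (e.symm ∘ Sum.inl) (e.symm ∘ Sum.inl) with hB
  have hB1 : B.map (Int.castRingHom (ZMod p)) = 1 := by
    rw [hB, ← Matrix.submatrix_map, Matrix.map_mul, Matrix.map_mul, ← hA', h]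
    ext i j
    simp
  have hdet : B.det ≠ 0 := by
    intro h0
    have := congrArg Matrix.det hB1
    rw [← RingHom.mapMatrix_apply, ← RingHom.map_det, h0] at this
    simp at this
  have hdetQ : (B.map (Int.castRingHom ℚ)).det ≠ 0 := by
    rw [← RingHom.mapMatrix_apply, ← RingHom.map_det]
    simpa using hdet
  calc A'.rank = (B.map (Int.castRingHom ℚ)).rank := by
        rw [Matrix.rank_of_det_ne_zero hdetQ, Fintype.card_fin]
    _ ≤ ((V' * A * U').map (Int.castRingHom ℚ)).rank := by
        rw [hB, ← Matrix.submatrix_map]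
        exact Matrix.rank_submatrix_le _ _ _
    _ ≤ (A.map (Int.castRingHom ℚ)).rank := by
        rw [Matrix.map_mul, Matrix.map_mul]
        exact (Matrix.rank_mul_le_left _ _).trans (Matrix.rank_mul_le_right _ _)

/-- From `A (D - A) = 0` the ranks add up to at most the size; from `A + (D - A) = D` invertible, to
at least the size. -/
theorem rank_add_rank_eq_card {K : Type*} [Field K] (A : Matrix m m K) (d : m → K)
    (hd : ∀ i, d i ≠ 0) (h : A * A = A * diagonal d) :
    A.rank + (diagonal d - A).rank = Fintype.card m := by
  refine le_antisymm (rank_add_rank_le_card_of_mul_eq_zero ?_) ?_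
  · rw [mul_sub, h, sub_self]
  · have h1 : (diagonal d).rank = Fintype.card m := by
      refine rank_of_det_ne_zero ?_
      rw [det_diagonal]
      exact Finset.prod_ne_zero_iff.2 fun i _ => hd i
    rw [← h1]
    exact (congrArg Matrix.rank (add_sub_cancel A (diagonal d)).symm).le.trans (rank_add_le' _ _)

/-- The ranks of `A` and `D - A` have the same sum over both fields, and neither can increase modulo
`p`, so neither can drop. -/
theorem rank_map_zmod_eq (p : ℕ) [Fact p.Prime] (A : Matrix m m ℤ) (d : m → ℤ)
    (hd : ∀ i, (d i : ZMod p) ≠ 0) (h : A * A = A * diagonal d) :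
    (A.map (Int.castRingHom (ZMod p))).rank = (A.map (Int.castRingHom ℚ)).rank := by
  have hK : ∀ (K : Type) [Field K], (∀ i, (d i : K) ≠ 0) →
      (A.map (Int.castRingHom K)).rank + ((diagonal d - A).map (Int.castRingHom K)).rank =
        Fintype.card m := by
    intro K _ hdK
    have h1 := rank_add_rank_eq_card (A.map (Int.castRingHom K)) (fun i => (d i : K)) hdK (by
      have := congrArg (fun B : Matrix m m ℤ => B.map (Int.castRingHom K)) h
      simp only [Matrix.map_mul] at this
      rw [this]
      congr 1
      rw [diagonal_map (by simp)]
      rfl)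
    rw [← h1]
    congr 2
    rw [Matrix.map_sub _ (by simp), diagonal_map (by simp)]
    rfl
  have h1 := hK (ZMod p) hd
  have h2 := hK ℚ fun i hi => hd i (by
    have : d i = 0 := by exact_mod_cast hi
    simp [this])
  have h3 := rank_map_zmod_le p A
  have h4 := rank_map_zmod_le p (diagonal d - A)
  omega

end Rank

/-! ### A Dynkin-type operator and the dimension of the homogeneous components -/

section Dynkin

variable (K : Type) [Field K]

/-- The endomorphism `(a, t) ↦ ([X_i, a] + t T_i, 0)`, where `T_0 = X_0` and `T_1 = 0`. -/
noncomputable def dynkinEnd (i : Fin 2) : Module.End K (FreeAlgebra K (Fin 2) × K) :=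
  LinearMap.inl K (FreeAlgebra K (Fin 2)) K ∘ₗ
    (LieAlgebra.ad K (FreeAlgebra K (Fin 2)) (FreeAlgebra.ι K i)).coprod
      (LinearMap.toSpanSingleton K _ (if i = 0 then FreeAlgebra.ι K i else 0))

/-- The linear map that sends a word ending in `X_0` to its right-nested bracket, and a word
ending in `X_1` to zero. -/
noncomputable def dynkin : FreeAlgebra K (Fin 2) →ₗ[K] FreeAlgebra K (Fin 2) :=
  LinearMap.fst K _ K ∘ₗ LinearMap.applyₗ ((0, 1) : FreeAlgebra K (Fin 2) × K) ∘ₗ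
    (FreeAlgebra.lift K (dynkinEnd K)).toLinearMap

variable {K}

theorem dynkinEnd_apply (i : Fin 2) (x : FreeAlgebra K (Fin 2) × K) :
    dynkinEnd K i x =
      (⁅FreeAlgebra.ι K i, x.1⁆ + x.2 • (if i = 0 then FreeAlgebra.ι K i else 0), 0) := rfl

theorem dynkin_apply (a : FreeAlgebra K (Fin 2)) :
    dynkin K a = (FreeAlgebra.lift K (dynkinEnd K) a (0, 1)).1 := rfl

theorem lie_smul_freeAlgebra (c : K) (a b : FreeAlgebra K (Fin 2)) :
    ⁅a, c • b⁆ = c • ⁅a, b⁆ := by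
  rw [Ring.lie_def, Ring.lie_def, mul_smul_comm, smul_mul_assoc, smul_sub]

/-- A Lie element `u` acts by `(a, t) ↦ ([u, a] + t δ(u), 0)`, where `δ` is the derivation with `δ
X_0 = X_0` and `δ X_1 = 0`. The Jacobi identity and the Leibniz rule preserve this form under
brackets, and `δ` multiplies a nested bracket by its number of letters `X_0`. -/
theorem lift_dynkinEnd_nest (w : List (Fin 2)) (x : FreeAlgebra K (Fin 2) × K) :
    FreeAlgebra.lift K (dynkinEnd K) (nest K w) x =
      (⁅nest K w, x.1⁆ + x.2 • (w.count 0 : K) • nest K w, 0) := by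
  induction w generalizing x with
  | nil => simp [nest, Prod.zero_eq_mk]
  | cons i w ih =>
    rcases eq_or_ne w [] with rfl | hw
    · rw [nest, FreeAlgebra.lift_ι_apply, dynkinEnd_apply]
      by_cases h : i = 0 <;> simp [h]
    · rw [nest_cons i hw, Ring.lie_def, map_sub, map_mul, map_mul, FreeAlgebra.lift_ι_apply,
        LinearMap.sub_apply, Module.End.mul_apply, Module.End.mul_apply, ih, ih, dynkinEnd_apply,
        dynkinEnd_apply, ← Ring.lie_def]
      by_cases h : i = 0
      · subst h
        simp only [if_true, List.count_cons_self, Prod.mk_sub_mk, zero_smul, add_zero, sub_zero,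
          lie_add, lie_smul_freeAlgebra, lie_lie, Nat.cast_add, Nat.cast_one, add_smul, one_smul, smul_add]
        rw [← lie_skew (FreeAlgebra.ι K 0) (nest K w)]
        congr 1
        module
      · rw [List.count_cons_of_ne h]
        simp only [if_neg h, Prod.mk_sub_mk, zero_smul, smul_zero, add_zero, sub_zero,
          lie_add, lie_smul_freeAlgebra, lie_lie]
        congr 1
        module

theorem dynkin_nest (w : List (Fin 2)) : dynkin K (nest K w) = (w.count 0 : K) • nest K w := by
  simp [dynkin_apply, lift_dynkinEnd_nest]

theorem lift_dynkinEnd_word (w : List (Fin 2)) (i : Fin 2) :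
    FreeAlgebra.lift K (dynkinEnd K) (word K (w ++ [i])) (0, 1) =
      (if i = 0 then nest K (w ++ [i]) else 0, 0) := by
  induction w with
  | nil =>
    rw [List.nil_append, word_singleton, FreeAlgebra.lift_ι_apply, dynkinEnd_apply]
    simp [nest]
  | cons j w ih =>
    rw [List.cons_append, word_cons, map_mul, Module.End.mul_apply, ih, FreeAlgebra.lift_ι_apply,
      dynkinEnd_apply, nest_cons j (by simp)]
    split_ifs <;> simp

theorem dynkin_word {w : List (Fin 2)} (hw : w ≠ []) :
    dynkin K (word K w) = if w.getLast? = some 0 then nest K w else 0 := by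
  obtain ⟨v, i, rfl⟩ := (List.eq_nil_or_concat w).resolve_left hw
  rw [List.concat_eq_append, dynkin_apply, lift_dynkinEnd_word]
  simp

theorem nest_replicate (n : ℕ) (i : Fin 2) : nest K (List.replicate (n + 2) i) = 0 := by
  induction n with
  | zero => simp [nest, List.replicate]
  | succ n ih =>
    rw [List.replicate_succ, nest_cons i (by simp), ih, lie_zero]

theorem nest_eq_zero_or {w : List (Fin 2)} (hw : 2 ≤ w.length) :
    nest K w = 0 ∨ (0 < w.count 0 ∧ w.count 0 < w.length) := by
  obtain ⟨n, hn⟩ : ∃ n, w.length = n + 2 := ⟨w.length - 2, by omega⟩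
  by_cases h0 : w.count 0 = 0
  · left
    have : w = List.replicate (n + 2) 1 := by
      refine List.eq_replicate_iff.2 ⟨hn, fun b hb => ?_⟩
      have : b ≠ 0 := fun h => List.count_eq_zero.1 h0 (h ▸ hb)
      omega
    rw [this, nest_replicate]
  by_cases h1 : w.count 0 = w.length
  · left
    have : w = List.replicate (n + 2) 0 :=
      List.eq_replicate_iff.2 ⟨hn, fun b hb => (List.count_eq_length.1 h1 b hb).symm⟩
    rw [this, nest_replicate]
  · right
    have := w.count_le_length (a := (0 : Fin 2))
    omega

/-- A nonzero nested bracket is an eigenvector of `dynkin` whose eigenvalue lies strictly between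
`0` and `n`. Counting all letters, as the classical Dynkin operator does, would give the eigenvalue
`n`, which is not invertible in the case `p = n = k + 1` needed later. -/
theorem lieDeg_eq_span_dynkin {n : ℕ} (hn : 2 ≤ n) (hK : ∀ a : ℕ, 0 < a → a < n → (a : K) ≠ 0) :
    lieDeg K n = Submodule.span K ((fun w => dynkin K (word K w)) '' {w | w.length = n}) := by
  refine le_antisymm ?_ (Submodule.span_le.2 ?_)
  · rw [lieDeg_eq_span, Submodule.span_le]
    rintro _ ⟨w, rfl, rfl⟩
    rcases nest_eq_zero_or (K := K) hn with h | h
    · rw [h]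
      exact zero_mem _
    · have h1 : nest K w = (w.count 0 : K)⁻¹ • dynkin K (nest K w) := by
        rw [dynkin_nest, smul_smul, inv_mul_cancel₀ (hK _ h.1 h.2), one_smul]
      rw [h1]
      refine Submodule.smul_mem _ _ ?_
      have h2 := Submodule.mem_map_of_mem (f := dynkin K) (nest_mem_lieDeg w).2
      rw [wordSpan, Submodule.map_span] at h2
      refine Submodule.span_mono ?_ h2
      rintro _ ⟨_, ⟨v, hv, rfl⟩, rfl⟩
      exact ⟨v, hv, rfl⟩
  · rintro _ ⟨w, rfl, rfl⟩
    have hw : w ≠ [] := by rintro rfl; simp at hn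
    simp only [SetLike.mem_coe, dynkin_word hw]
    split_ifs
    · exact nest_mem_lieDeg w
    · exact zero_mem _

/-- The coefficient of the word `z` in the right-nested bracket of the word `w`. -/
def nestCoeff : List (Fin 2) → List (Fin 2) → ℤ
  | [], _ => 0
  | [i], z => if z = [i] then 1 else 0
  | i :: j :: w, z => (if z.head? = some i then nestCoeff (j :: w) z.tail else 0) -
      (if z.getLast? = some i then nestCoeff (j :: w) z.dropLast else 0)

theorem wcoeff_nest (w z : List (Fin 2)) : wcoeff K z (nest K w) = nestCoeff w z := by
  induction w generalizing z with
  | nil => simp [nest, nestCoeff]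
  | cons i w ih =>
    cases w with
    | nil =>
      rw [nest, nestCoeff, ← word_singleton, wcoeff_word]
      simp [eq_comm]
    | cons j w =>
      rw [nest, nestCoeff, Ring.lie_def, map_sub, wcoeff_ι_mul, wcoeff_mul_ι, ih, ih]
      push_cast
      rfl

/-- The matrix of `dynkin` on the words of length `n`. -/
def dynkinMatrix (n : ℕ) : Matrix (List.Vector (Fin 2) n) (List.Vector (Fin 2) n) ℤ :=
  fun z w => if w.1.getLast? = some 0 then nestCoeff w.1 z.1 else 0

/-- The number of letters `X_0`, replaced by `1` for constant words. -/
def dynkinEigenvalue (n : ℕ) (w : List.Vector (Fin 2) n) : ℤ :=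
  if 0 < w.1.count 0 ∧ w.1.count 0 < n then w.1.count 0 else 1

theorem wcoeff_dynkin_word {n : ℕ} (hn : n ≠ 0) (z w : List.Vector (Fin 2) n) :
    wcoeff K z.1 (dynkin K (word K w.1)) = dynkinMatrix n z w := by
  have hw : w.1 ≠ [] := by
    intro h
    have := w.2
    rw [h] at this
    exact hn this.symm
  rw [dynkin_word hw, dynkinMatrix]
  split_ifs <;> simp [wcoeff_nest]

theorem eq_sum_wcoeff {n : ℕ} {a : FreeAlgebra K (Fin 2)} (ha : a ∈ wordSpan K n) :
    a = ∑ z : List.Vector (Fin 2) n, wcoeff K z.1 a • word K z.1 := by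
  refine wcoeff_ext fun y => ?_
  simp only [map_sum, map_smul, wcoeff_word, smul_eq_mul, mul_ite, mul_one, mul_zero]
  by_cases hy : y.length = n
  · rw [Finset.sum_eq_single ⟨y, hy⟩]
    · simp
    · intro z _ hz
      exact if_neg fun h => hz (Subtype.ext h)
    · exact fun h => absurd (Finset.mem_univ _) h
  · rw [wcoeff_eq_zero_of_mem_wordSpan ha hy, Finset.sum_eq_zero]
    intro z _
    refine if_neg ?_
    rintro rfl
    exact hy z.2

theorem dynkin_word_mem {n : ℕ} (hn : n ≠ 0) (w : List.Vector (Fin 2) n) :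
    dynkin K (word K w.1) ∈ wordSpan K n := by
  have hw : w.1 ≠ [] := by
    intro h
    have := w.2
    rw [h] at this
    exact hn this.symm
  rw [dynkin_word hw]
  split_ifs
  · have := (nest_mem_lieDeg (K := K) w.1).2
    rwa [w.2] at this
  · exact zero_mem _

theorem dynkinMatrix_mul_self {n : ℕ} (hn : 2 ≤ n) :
    dynkinMatrix n * dynkinMatrix n =
      dynkinMatrix n * Matrix.diagonal (dynkinEigenvalue n) := by
  ext z w
  rw [Matrix.mul_diagonal, Matrix.mul_apply]
  have hw : w.1 ≠ [] := by
    intro h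
    have := w.2
    rw [h] at this
    simp at this
    omega
  -- The integer identity is checked in `ℚ` by computing one coefficient of `dynkin` applied twice
  -- in two ways.
  have h1 : wcoeff ℚ z.1 (dynkin ℚ (dynkin ℚ (word ℚ w.1))) =
      ((∑ y, dynkinMatrix n z y * dynkinMatrix n y w : ℤ) : ℚ) := by
    conv_lhs => rw [eq_sum_wcoeff (dynkin_word_mem (K := ℚ) (by omega) w)]
    simp only [map_sum, map_smul, smul_eq_mul]
    push_cast
    refine Finset.sum_congr rfl fun y _ => ?_
    rw [wcoeff_dynkin_word (by omega), wcoeff_dynkin_word (by omega), mul_comm]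
  have h2 : wcoeff ℚ z.1 (dynkin ℚ (dynkin ℚ (word ℚ w.1))) =
      ((dynkinMatrix n z w * dynkinEigenvalue n w : ℤ) : ℚ) := by
    push_cast
    rw [← wcoeff_dynkin_word (by omega), dynkin_word hw]
    split_ifs with h
    · rw [dynkin_nest, map_smul, smul_eq_mul, mul_comm]
      have hlen : w.1.length = n := w.2
      rcases nest_eq_zero_or (K := ℚ) (w := w.1) (by omega) with h0 | h0
      -- A vanishing bracket gives a zero column, so the value of the eigenvalue there does not
      -- matter; the default `1` keeps the diagonal invertible.
      · simp [h0]
      · rw [dynkinEigenvalue, if_pos ⟨h0.1, h0.2.trans_eq hlen⟩]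
        push_cast
        rfl
    · simp
  exact_mod_cast h1.symm.trans h2

/-- The vector of the coefficients of the words of length `n`. -/
noncomputable def coeffVec (K : Type) [Field K] (n : ℕ) :
    FreeAlgebra K (Fin 2) →ₗ[K] (List.Vector (Fin 2) n → K) :=
  LinearMap.pi fun z => wcoeff K z.1

/-- Taking coefficients is injective in degree `n` and carries the spanning set of
`lieDeg_eq_span_dynkin` to the columns of the matrix. -/
theorem finrank_lieDeg_eq_rank {n : ℕ} (hn : 2 ≤ n)
    (hK : ∀ a : ℕ, 0 < a → a < n → (a : K) ≠ 0) :
    Module.finrank K (lieDeg K n) = ((dynkinMatrix n).map (Int.castRingHom K)).rank := by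
  have hmap : (lieDeg K n).map (coeffVec K n) =
      LinearMap.range ((dynkinMatrix n).map (Int.castRingHom K)).mulVecLin := by
    rw [Matrix.range_mulVecLin, lieDeg_eq_span_dynkin hn hK, Submodule.map_span]
    congr 1
    ext x
    constructor
    · rintro ⟨_, ⟨w, hw, rfl⟩, rfl⟩
      exact ⟨⟨w, hw⟩, funext fun z => (wcoeff_dynkin_word (by omega) z ⟨w, hw⟩).symm⟩
    · rintro ⟨w, rfl⟩
      exact ⟨_, ⟨w.1, w.2, rfl⟩, funext fun z => wcoeff_dynkin_word (by omega) z w⟩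
  rw [Matrix.rank, ← hmap]
  refine (LinearEquiv.finrank_eq (LinearEquiv.ofInjective
    ((coeffVec K n).domRestrict (lieDeg K n)) ?_)).trans ?_
  · rw [← LinearMap.ker_eq_bot, LinearMap.ker_eq_bot']
    rintro ⟨a, ha⟩ h
    have h' : ∀ z : List.Vector (Fin 2) n, wcoeff K z.1 a = 0 := fun z => congrFun h z
    refine Subtype.ext ?_
    change a = 0
    rw [eq_sum_wcoeff ha.2]
    exact Finset.sum_eq_zero fun z _ => by rw [h', zero_smul]
  · rw [LinearMap.range_domRestrict]

/-- The dimension of the homogeneous Lie polynomials of degree `n`, for large characteristic. -/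
noncomputable def lieDim (n : ℕ) : ℕ := ((dynkinMatrix n).map (Int.castRingHom ℚ)).rank

theorem natCast_zmod_ne_zero {p a : ℕ} (h0 : 0 < a) (h : a < p) : (a : ZMod p) ≠ 0 := by
  rw [Ne, ZMod.natCast_eq_zero_iff]
  exact fun hd => h.not_ge (Nat.le_of_dvd h0 hd)

theorem finrank_lieDeg {n p : ℕ} [Fact p.Prime] (hn : 2 ≤ n) (hp : n ≤ p) :
    Module.finrank (ZMod p) (lieDeg (ZMod p) n) = lieDim n := by
  rw [finrank_lieDeg_eq_rank hn fun a h0 h => natCast_zmod_ne_zero h0 (by omega), lieDim,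
    rank_map_zmod_eq p _ (dynkinEigenvalue n) ?_ (dynkinMatrix_mul_self hn)]
  intro w
  rw [dynkinEigenvalue]
  split_ifs with h
  · exact_mod_cast natCast_zmod_ne_zero h.1 (h.2.trans_le hp)
  · simp

end Dynkin

/-! ### The layers of the free nilpotent Lie algebra -/

section Layer

variable (K : Type) [Field K]

/-- The span of the words of length at least `n`. -/
def wordSpanGE (n : ℕ) : Submodule K (FreeAlgebra K (Fin 2)) :=
  Submodule.span K (word K '' {w | n ≤ w.length})

variable {K}

theorem mul_mem_wordSpanGE {m n : ℕ} {a b : FreeAlgebra K (Fin 2)} (ha : a ∈ wordSpanGE K m)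
    (hb : b ∈ wordSpanGE K n) : a * b ∈ wordSpanGE K (m + n) := by
  have := Submodule.mul_mem_mul ha hb
  rw [wordSpanGE, wordSpanGE, Submodule.span_mul_span] at this
  refine Submodule.span_mono ?_ this
  rintro _ ⟨_, ⟨v, hv, rfl⟩, _, ⟨w, hw, rfl⟩, rfl⟩
  refine ⟨v ++ w, ?_, word_append v w⟩
  simp only [Set.mem_ofPred_eq, List.length_append] at hv hw ⊢
  omega

theorem lie_mem_wordSpanGE {m n : ℕ} {a b : FreeAlgebra K (Fin 2)} (ha : a ∈ wordSpanGE K m)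
    (hb : b ∈ wordSpanGE K n) : ⁅a, b⁆ ∈ wordSpanGE K (m + n) := by
  rw [Ring.lie_def]
  exact sub_mem (mul_mem_wordSpanGE ha hb) (add_comm n m ▸ mul_mem_wordSpanGE hb ha)

theorem wordSpanGE_anti {m n : ℕ} (h : m ≤ n) : wordSpanGE K n ≤ wordSpanGE K m :=
  Submodule.span_mono (Set.image_mono fun _ hw => h.trans hw)

theorem LiePoly_le_wordSpanGE : (LiePoly K).toSubmodule ≤ wordSpanGE K 1 := by
  intro a ha
  change a ∈ LiePoly K at ha
  induction ha using LieSubalgebra.lieSpan_induction with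
  | mem x hx =>
    obtain ⟨i, rfl⟩ := hx
    exact Submodule.subset_span ⟨[i], by simp, word_singleton i⟩
  | zero => exact zero_mem _
  | add x y _ _ hx hy => exact add_mem hx hy
  | smul c x _ hx => exact Submodule.smul_mem _ c hx
  | lie x y _ _ hx hy => exact wordSpanGE_anti (by omega) (lie_mem_wordSpanGE hx hy)

/-- Each bracket with a Lie polynomial lengthens all words by at least one letter. Consequently the
quotient by index `c` identifies no two homogeneous elements of the same degree `n ≤ c`. -/
theorem lowerCentralSeries_le (c : ℕ) :
    (LieModule.lowerCentralSeries K (LiePoly K) (LiePoly K) c).toSubmodule ≤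
      (wordSpanGE K (c + 1)).comap (LiePoly K).toSubmodule.subtype := by
  induction c with
  | zero => exact fun x _ => LiePoly_le_wordSpanGE x.2
  | succ c ih =>
    rw [LieModule.lowerCentralSeries_succ, LieSubmodule.lieIdeal_oper_eq_linear_span',
      Submodule.span_le]
    rintro _ ⟨x, -, y, hy, rfl⟩
    have := lie_mem_wordSpanGE (LiePoly_le_wordSpanGE x.2) (ih hy)
    rwa [add_comm] at this

theorem eq_zero_of_mem_wordSpanGE {n m : ℕ} (h : n < m) {a : FreeAlgebra K (Fin 2)}
    (ha : a ∈ wordSpan K n) (ha' : a ∈ wordSpanGE K m) : a = 0 := by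
  refine wcoeff_ext fun z => ?_
  rw [map_zero]
  by_cases hz : z.length = n
  · have : wordSpanGE K m ≤ LinearMap.ker (wcoeff K z) := by
      refine Submodule.span_le.2 ?_
      rintro _ ⟨w, hw, rfl⟩
      change wcoeff K z (word K w) = 0
      rw [wcoeff_word, if_neg]
      rintro rfl
      have : m ≤ w.length := hw
      omega
    exact this ha'
  · exact wcoeff_eq_zero_of_mem_wordSpan ha hz

variable (K) in
/-- The classes in `𝔣_{c,2}(K)` of the homogeneous Lie polynomials of degree `n`. -/
noncomputable def toLayer (c n : ℕ) : lieDeg K n →ₗ[K] FreeNilp K c :=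
  proj K c ∘ₗ Submodule.inclusion (inf_le_left : lieDeg K n ≤ (LiePoly K).toSubmodule)

theorem toLayer_injective {c n : ℕ} (h : n ≤ c) : Function.Injective (toLayer K c n) := by
  rw [← LinearMap.ker_eq_bot, LinearMap.ker_eq_bot']
  rintro ⟨a, ha⟩ h0
  have h1 : (⟨a, ha.1⟩ : LiePoly K) ∈ LieModule.lowerCentralSeries K (LiePoly K) (LiePoly K) c :=
    (Submodule.Quotient.mk_eq_zero _).1 h0
  exact Subtype.ext (eq_zero_of_mem_wordSpanGE (Nat.lt_succ_of_le h) ha.2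
    (lowerCentralSeries_le c h1))

theorem range_toLayer (c n : ℕ) : LinearMap.range (toLayer K c n) = layer K c n := by
  refine le_antisymm ?_ ?_
  · rintro _ ⟨a, rfl⟩
    exact ⟨⟨a.1, a.2.1⟩, a.2.2, rfl⟩
  · rintro _ ⟨a, ha, rfl⟩
    exact ⟨⟨a.1, a.2, ha⟩, rfl⟩

theorem lie_mem_lieDeg {n : ℕ} (j : Fin 2) {u : FreeAlgebra K (Fin 2)} (hu : u ∈ lieDeg K n) :
    ⁅FreeAlgebra.ι K j, u⁆ ∈ lieDeg K (n + 1) :=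
  ⟨(LiePoly K).lie_mem (ι_mem_LiePoly j) hu.1,
    add_comm n 1 ▸ lie_mem_wordSpan (ι_mem_wordSpan j) hu.2⟩

theorem phi_toLayer (c n : ℕ) (j : Fin 2) (u : lieDeg K n) :
    phi K c j (toLayer K c n u) =
      toLayer K c (n + 1) ⟨⁅FreeAlgebra.ι K j, u.1⁆, lie_mem_lieDeg j u.2⟩ := rfl

instance finiteDimensional_lieDeg (n : ℕ) : FiniteDimensional K (lieDeg K n) := by
  rw [lieDeg_eq_span]
  exact FiniteDimensional.span_of_finite K ((List.finite_length_eq (Fin 2) n).image _)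

theorem finrank_layer {c n : ℕ} (h : n ≤ c) :
    Module.finrank K (layer K c n) = Module.finrank K (lieDeg K n) := by
  rw [← range_toLayer]
  exact LinearMap.finrank_range_of_inj (toLayer_injective h)

theorem phi_toLayer_injective {c n : ℕ} (hn : 2 ≤ n) (hn0 : (n : K) ≠ 0) (h : n + 1 ≤ c)
    (j : Fin 2) : Function.Injective (phi K c j ∘ₗ toLayer K c n) := by
  rw [← LinearMap.ker_eq_bot, LinearMap.ker_eq_bot']
  intro u hu
  rw [LinearMap.comp_apply, phi_toLayer] at hu
  have := (map_eq_zero_iff _ (toLayer_injective h)).1 hu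
  exact Subtype.ext (eq_zero_of_lie_eq_zero hn hn0 j u.2 (congrArg Subtype.val this))

theorem disjoint_comap_phi {c n : ℕ} (hn : 2 ≤ n) (hn0 : (n : K) ≠ 0) (h : n + 1 ≤ c) :
    Disjoint
      ((LinearMap.range (phi K c 1 ∘ₗ toLayer K c n)).comap (phi K c 0 ∘ₗ toLayer K c n))
      ((LinearMap.range (phi K c 0 ∘ₗ toLayer K c n)).comap (phi K c 1 ∘ₗ toLayer K c n)) := by
  rw [Submodule.disjoint_def]
  rintro u ⟨v, hv⟩ ⟨v', hv'⟩
  simp only [LinearMap.comp_apply, phi_toLayer] at hv hv'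
  have h0 := congrArg Subtype.val (toLayer_injective h hv)
  have h1 := congrArg Subtype.val (toLayer_injective h hv')
  exact Subtype.ext (eq_zero_of_lie_eq_lie hn hn0 u.2 h0.symm h1.symm)

theorem layer_succ {c n : ℕ} (hn : n ≠ 0) :
    layer K c (n + 1) = (layer K c n).map (phi K c 0) ⊔ (layer K c n).map (phi K c 1) := by
  simp only [← range_toLayer]
  refine le_antisymm ?_ (sup_le ?_ ?_)
  · rintro _ ⟨⟨a, ha⟩, rfl⟩
    have ha' := ha
    rw [lieDeg_succ hn] at ha'
    obtain ⟨_, ⟨x, hx, rfl⟩, _, ⟨y, hy, rfl⟩, rfl⟩ := Submodule.mem_sup.1 ha'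
    refine Submodule.mem_sup.2 ⟨_, ⟨_, ⟨⟨x, hx⟩, rfl⟩, rfl⟩, _, ⟨_, ⟨⟨y, hy⟩, rfl⟩, rfl⟩, ?_⟩
    rw [phi_toLayer, phi_toLayer, ← map_add]
    rfl
  all_goals
    rintro _ ⟨_, ⟨u, rfl⟩, rfl⟩
    exact ⟨_, (phi_toLayer c n _ u).symm⟩

theorem finrank_map_phi_layer {c n : ℕ} (hn : 2 ≤ n) (hn0 : (n : K) ≠ 0) (h : n + 1 ≤ c)
    (j : Fin 2) :
    Module.finrank K ((layer K c n).map (phi K c j)) = Module.finrank K (lieDeg K n) := by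
  rw [← range_toLayer, ← LinearMap.range_comp]
  exact LinearMap.finrank_range_of_inj (phi_toLayer_injective hn hn0 h j)

/-- The two images have the dimension of the layer, and their sum is the next layer. The
natural-number subtraction is therefore exact. -/
theorem finrank_collapse_layer {c n : ℕ} (hn : 2 ≤ n) (hn0 : (n : K) ≠ 0) (h : n + 1 ≤ c) :
    Module.finrank K (collapse K c (layer K c n)) =
      2 * Module.finrank K (lieDeg K n) - Module.finrank K (lieDeg K (n + 1)) := by
  have : FiniteDimensional K (layer K c n) := by
    rw [← range_toLayer]
    infer_instance
  have h1 := Submodule.finrank_sup_add_finrank_inf_eq ((layer K c n).map (phi K c 0))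
    ((layer K c n).map (phi K c 1))
  rw [finrank_map_phi_layer hn hn0 h, finrank_map_phi_layer hn hn0 h, ← layer_succ (by omega),
    finrank_layer h] at h1
  rw [collapse]
  omega

/-- Moves the count to subspaces of `lieDeg K n`, the form that `card_finrank_map_inf_map` requires.
-/
theorem countCol_eq {c n : ℕ} (h : n ≤ c) (m i : ℕ) :
    countCol K c n m i = Nat.card {I : Submodule K (lieDeg K n) // Module.finrank K I = m ∧
      Module.finrank K (I.map (phi K c 0 ∘ₗ toLayer K c n) ⊓
        I.map (phi K c 1 ∘ₗ toLayer K c n) : Submodule K (FreeNilp K c)) = i} := by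
  have hinj := toLayer_injective (K := K) h
  have hcol : ∀ J : Submodule K (lieDeg K n), dimCol K c (J.map (toLayer K c n)) =
      Module.finrank K (J.map (phi K c 0 ∘ₗ toLayer K c n) ⊓
        J.map (phi K c 1 ∘ₗ toLayer K c n) : Submodule K (FreeNilp K c)) := fun J => by
    rw [dimCol, collapse, Submodule.map_comp, Submodule.map_comp]
  have hfin : ∀ J : Submodule K (lieDeg K n),
      Module.finrank K (J.map (toLayer K c n)) = Module.finrank K J := fun J =>
    (Submodule.equivMapOfInjective _ hinj J).finrank_eq.symm
  have hmc : ∀ I ≤ layer K c n, (I.comap (toLayer K c n)).map (toLayer K c n) = I := by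
    intro I hI
    rw [Submodule.map_comap_eq, range_toLayer, inf_eq_right.2 hI]
  rw [countCol]
  refine Nat.card_congr
    { toFun := fun I => ⟨I.1.comap (toLayer K c n), ?_, ?_⟩
      invFun := fun J => ⟨J.1.map (toLayer K c n), range_toLayer (K := K) c n ▸
        LinearMap.map_le_range, (hfin _).trans J.2.1, (hcol _).trans J.2.2⟩
      left_inv := fun I => Subtype.ext (hmc _ I.2.1)
      right_inv := fun J => Subtype.ext (Submodule.comap_map_eq_of_injective hinj _) }
  · rw [← hfin, hmc _ I.2.1, I.2.2.1]
  · rw [← hcol, hmc _ I.2.1, I.2.2.2]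

end Layer

end FreeNilLie

/-! ### The main theorem -/

theorem mainTheorem5 (k : ℕ) (hk : 1 < k) :
    ∃ d l : ℕ, ∀ m i : ℕ, ∃ P : ℤ[X],
      ∀ (c p : ℕ) [Fact p.Prime], k ≤ c - 1 → c ≤ p →
        Module.finrank (ZMod p) (FreeNilLie.layer (ZMod p) c k) = d ∧
        Module.finrank (ZMod p)
          (FreeNilLie.collapse (ZMod p) c (FreeNilLie.layer (ZMod p) c k)) = l ∧
        (FreeNilLie.countCol (ZMod p) c k m i : ℤ) = P.eval (p : ℤ) ∧
        (FreeNilLie.countCol (ZMod p) c k m i : ℚ) = FreeNilLie.colFormula d l m i (p : ℚ) := by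
  open FreeNilLie in
  refine ⟨lieDim k, 2 * lieDim k - lieDim (k + 1), fun m i =>
    ⟨colPoly (lieDim k) (2 * lieDim k - lieDim (k + 1)) m i, fun c p _ hc hp => ?_⟩⟩
  have hkc : k + 1 ≤ c := by omega
  have hk0 : ((k : ℕ) : ZMod p) ≠ 0 := natCast_zmod_ne_zero (by omega) (by omega)
  have hd : Module.finrank (ZMod p) (lieDeg (ZMod p) k) = lieDim k :=
    finrank_lieDeg hk (by omega)
  have hl : Module.finrank (ZMod p) (collapse (ZMod p) c (layer (ZMod p) c k)) =
      2 * lieDim k - lieDim (k + 1) := by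
    -- Degree `k + 1` needs only `k + 1 ≤ p`, which follows from `k + 1 ≤ c ≤ p`.
    rw [finrank_collapse_layer hk hk0 hkc, hd, finrank_lieDeg (by omega) (by omega)]
  have : Finite (lieDeg (ZMod p) k) := Module.finite_of_finite (ZMod p)
  have hcount : (countCol (ZMod p) c k m i : ℚ) =
      colFormula (lieDim k) (2 * lieDim k - lieDim (k + 1)) m i (p : ℚ) := by
    rw [countCol_eq (by omega), card_finrank_map_inf_map (phi_toLayer_injective hk hk0 hkc 0)
      (phi_toLayer_injective hk hk0 hkc 1) (disjoint_comap_phi hk hk0 hkc), hd, ZMod.card, ← hl,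
      Submodule.map_comp, Submodule.map_comp, Submodule.map_top, range_toLayer, collapse]
  refine ⟨(finrank_layer (by omega)).trans hd, hl, ?_, hcount⟩
  have hp1 : (1 : ℤ) < p := by exact_mod_cast (Fact.out : p.Prime).one_lt
  have := eval_colPoly hp1 (lieDim k) (2 * lieDim k - lieDim (k + 1)) m i
  rw [Int.cast_natCast, ← hcount] at this
  exact_mod_cast this.symm
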